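/- **Definitions.** Let $n\ge 1$; all matrices are real. - A square matrix $A$ is *irreducible* if its directed graph (an arc $i\to j$ whenever $a_{ij}\ne 0$) is strongly connected; *tridiagonal* if $a_{ij}=0$ whenever $|i-j|>1$; an *M-matrix* if $A=tI-B$ with $B$ entrywise nonnegative and spectral radius $\rho(B)\le t$; *row diagonally dominant* if $|a_{ii}|\ge\sum_{j\ne i}|a_{ij}|$ for all $i$, and *column diagonally dominant* if $A^T$ is row diagonally dominant; *totally nonnegative* if all its minors are nonnegative. - $C=[c_{ij}]\in\mathbb R^{n,n}$ is a *generalized ultrametric matrix* if it is entrywise nonnegative, $c_{ii}\ge\max\{c_{ij},c_{ji}\}$ for all $i,j$, and every set of three distinct indices has a labeling $\{i,j,k\}$ such that $c_{ij}=c_{ik}$, $c_{ji}=c_{ki}$, $\min\{c_{jk},c_{kj}\}\ge\min\{c_{ji},c_{ij}\}$ and $\max\{c_{jk},c_{kj}\}\ge\max\{c_{ji},c_{ij}\}$. - For $0\le m\le n$, $C\in\mathbb R^{n,n}$ is a *cyclops with eye $m+$ and parameters* $a_1,\dots,a_n,b_1,b_2$ if $a_1>a_2>\dots>a_m$, $a_n>a_{n-1}>\dots>a_{m+1}$,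 and $$c_{ij}=\begin{cases}a_{\max\{i,j\}}, & i,j\le m,\\ a_{\min\{i,j\}}, & i,j\ge m+1,\\ b_1, & i\le m<j,\\ b_2, & j\le m<i.\end{cases}$$ **Theorem.** Let $C\in\mathbb R^{n,n}$ ($n\ge1$) be nonsingular. The following are equivalent. (i) There is $m\in\{1,\dots,n\}$ such that $C^{-1}$ is an irreducible, row and column diagonally dominant, tridiagonal M-matrix, all of whose row sums vanish except at least one of the $m$-th and the $(m+1)$-st, and all of whose column sums vanish except at least one of the $m$-th and the $(m+1)$-st. (That is, the row sums with index other than $m,m+1$ are zero and at least one of those with index $m,m+1$ is nonzero; likewise for columns. For $m=n$ there is no $(m+1)$-st row or column.) (ii) There are $m\in\{1,\dots,n\}$ and $a_1,\dots,a_n,b_1,b_2\in\mathbb R$ such that $C$ is a cyclops with eye $m+$ and parameters $a_i,b_1,b_2$ satisfying $$\min\{a_m,a_{m+1}\}\ge\max\{b_1,b_2\}\quad\text{and}\quad\min\{b_1,b_2\}>0,$$ where for $m=n$ the first minimum is read as $a_n$. (iii) $C$ is an irreducible generalized ultrametric matrix whose inverse is tridiagonal. (iv) $C$ is a totally nonnegative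 irreducible generalized ultrametric matrix. -/

import Mathlib

/-- The `n × n` matrix `A` is irreducible: its directed graph, with an arc `i → j` whenever
`A i j ≠ 0`, is strongly connected. -/
def MatIrreducible {n : ℕ} (A : Matrix (Fin n) (Fin n) ℝ) : Prop :=
  ∀ i j : Fin n, Relation.ReflTransGen (fun p q : Fin n => A p q ≠ 0) i j

/-- `A` is tridiagonal: `A i j = 0` whenever `|i - j| > 1`. -/
def MatTridiagonal {n : ℕ} (A : Matrix (Fin n) (Fin n) ℝ) : Prop :=
  ∀ i j : Fin n, i.val + 1 < j.val ∨ j.val + 1 < i.val → A i j = 0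

/-- `A` is an M-matrix: `A = t I - B` with `B` entrywise nonnegative and `ρ(B) ≤ t`, where `ρ(B)`
is the largest modulus of a complex eigenvalue of `B`. As `ρ(B) ≥ 0`, such a `t` is nonnegative;
this is written out because `ENNReal.ofReal` truncates negative numbers. -/
def MatIsM {n : ℕ} (A : Matrix (Fin n) (Fin n) ℝ) : Prop :=
  ∃ (t : ℝ) (B : Matrix (Fin n) (Fin n) ℝ),
    (∀ i j, 0 ≤ B i j) ∧ 0 ≤ t ∧
    spectralRadius ℂ (B.map (fun x : ℝ => (x : ℂ))) ≤ ENNReal.ofReal t ∧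
    A = t • (1 : Matrix (Fin n) (Fin n) ℝ) - B

/-- Row diagonal dominance: `|a_ii| ≥ ∑_{j ≠ i} |a_ij|` for all `i`. -/
def MatRowDominant {n : ℕ} (A : Matrix (Fin n) (Fin n) ℝ) : Prop :=
  ∀ i, ∑ j ∈ Finset.univ.erase i, |A i j| ≤ |A i i|

/-- Column diagonal dominance. -/
def MatColDominant {n : ℕ} (A : Matrix (Fin n) (Fin n) ℝ) : Prop :=
  MatRowDominant A.transpose

/-- All row sums of `A` vanish except those of at least one of the rows number `m` and `m + 1`
(rows numbered `1, …, n`, so that `i : Fin n` is row number `i + 1`). -/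
def MatRowSumsVanishExcept {n : ℕ} (m : ℕ) (A : Matrix (Fin n) (Fin n) ℝ) : Prop :=
  (∀ i : Fin n, i.val + 1 ≠ m → i.val + 1 ≠ m + 1 → ∑ j, A i j = 0) ∧
  ∃ i : Fin n, (i.val + 1 = m ∨ i.val + 1 = m + 1) ∧ ∑ j, A i j ≠ 0

/-- All minors of `A` are nonnegative. -/
def MatTotallyNonneg {n : ℕ} (A : Matrix (Fin n) (Fin n) ℝ) : Prop :=
  ∀ (k : ℕ) (r c : Fin k → Fin n), StrictMono r → StrictMono c → 0 ≤ (A.submatrix r c).det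

/-- Generalized ultrametric matrices. -/
structure MatGenUltrametric {n : ℕ} (C : Matrix (Fin n) (Fin n) ℝ) : Prop where
  nonneg : ∀ i j, 0 ≤ C i j
  diag : ∀ i j, max (C i j) (C j i) ≤ C i i
  triple : ∀ S : Finset (Fin n), S.card = 3 → ∃ i j k : Fin n, S = {i, j, k} ∧
    C i j = C i k ∧
    C j i = C k i ∧
    min (C j i) (C i j) ≤ min (C j k) (C k j) ∧
    max (C j i) (C i j) ≤ max (C j k) (C k j)

/-- `A` is of type D with parameters `a`: `A i j = a_i` for `i ≤ j`, `A i j = a_j` for `i > j`,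
with `a` strictly increasing. -/
def MatTypeD {k : ℕ} (a : Fin k → ℝ) (A : Matrix (Fin k) (Fin k) ℝ) : Prop :=
  StrictMono a ∧ ∀ i j, A i j = if i ≤ j then a i else a j

/-- `A` is of flipped type D with parameters `a`: reversing the order of the indices gives a
type D matrix; the `i`-th parameter is the `i`-th diagonal entry of `A`. -/
def MatFlippedTypeD {k : ℕ} (a : Fin k → ℝ) (A : Matrix (Fin k) (Fin k) ℝ) : Prop :=
  MatTypeD (fun i => a i.rev) (A.submatrix Fin.rev Fin.rev)

/-- `C` is a cyclops with eye `m+` and parameters `a`, `b₁`, `b₂`: the leading `m × m` block is of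
flipped type D, the trailing `(n - m) × (n - m)` block is of type D, and the upper right and lower
left blocks are constant, equal to `b₁` and `b₂`. (`i : Fin n` is index number `i + 1`, so the
first block consists of the `i` with `i < m`.) -/
def MatCyclops {n : ℕ} (m : ℕ) (hm : m ≤ n) (a : Fin n → ℝ) (b₁ b₂ : ℝ)
    (C : Matrix (Fin n) (Fin n) ℝ) : Prop :=
  let first : Fin m → Fin n := fun i => ⟨i.val, by omega⟩
  let last : Fin (n - m) → Fin n := fun i => ⟨m + i.val, by omega⟩
  MatFlippedTypeD (fun i => a (first i)) (C.submatrix first first) ∧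
  MatTypeD (fun i => a (last i)) (C.submatrix last last) ∧
  (∀ i j, C (first i) (last j) = b₁) ∧
  (∀ i j, C (last i) (first j) = b₂)

/-! Everything is compared with `CyclopsForm`, the entrywise version of (ii) in which the parameters
are the diagonal entries. Three mechanisms carry the proof.

Tridiagonal inverse. For nonsingular `C` with nonzero diagonal, `C⁻¹` is tridiagonal exactly when `C
i k * C j j = C i j * C j k` for `i ≤ j ≤ k`, and likewise below the diagonal
(`matTridiagonal_inv_of_factor`, `factor_of_matTridiagonal_inv`). A cyclops has this property. It
also has the shape `h i * g j * min (ρ i) (ρ j)` with `ρ` monotone, whence total nonnegativity.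

Row sums. If a row of a tridiagonal `A` has zero sum and annihilates a vector that is constant up to
that row, the constancy passes to the next index. Applied to the columns of `C = A⁻¹` from both
ends, and to the transpose, this produces the blocks of a cyclops; the two rows at the eye form a
2×2 system that gives positivity and the bounds on `b₁`, `b₂`. Conversely, the row sums of `C⁻¹`
solve `C x = 1`, whose solution lives on the indices at the eye, and the signs of the entries of
`C⁻¹` come from the same equations.

Triples. Both (iii) and (iv) give `C i k * C j j ≤ C i j * C j k` for `i < j < k` and its mirror
image. With the ultrametric condition this makes each middle index behave as in a leading or as in a
trailing block (`MatGenUltrametric.middle`). Nonsingularity puts the leading type first, and the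
switch is the eye. -/

/-! ### Total nonnegativity of kernels of minima -/

/-- A kernel of minima of two nonnegative monotone sequences has nonnegative determinant. -/
theorem det_min_nonneg : ∀ (k : ℕ) (x y : Fin k → ℝ), Monotone x → Monotone y →
    (∀ i, 0 ≤ x i) → (∀ i, 0 ≤ y i) → 0 ≤ (Matrix.of fun i j => min (x i) (y j)).det := by
  -- When `y 0 ≤ x 0` the first column is constant. Subtracting the first row clears it below the
  -- corner and leaves the kernel of `x i.succ - x 0` and `max (y j.succ - x 0) 0`, again
  -- nonnegative and monotone. The other case is the transpose.
  have key : ∀ (k : ℕ), (∀ (x y : Fin k → ℝ), Monotone x → Monotone y →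
      (∀ i, 0 ≤ x i) → (∀ i, 0 ≤ y i) → 0 ≤ (Matrix.of fun i j => min (x i) (y j)).det) →
      ∀ (x y : Fin (k + 1) → ℝ), Monotone x → Monotone y →
      (∀ i, 0 ≤ x i) → (∀ i, 0 ≤ y i) → y 0 ≤ x 0 →
      0 ≤ (Matrix.of fun i j => min (x i) (y j)).det := by
    intro k ih x y hx hy hx0 hy0 h
    have hdet : (Matrix.of fun i j => min (x i) (y j)).det =
        (Matrix.of fun (i : Fin (k + 1)) j => if i = 0 then min (x 0) (y j)
          else min (x i) (y j) - min (x 0) (y j)).det := by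
      refine Matrix.det_eq_of_forall_row_eq_smul_add_const
        (fun i => if i = 0 then 0 else 1) 0 (by simp) ?_
      intro i j
      by_cases hi : i = 0 <;> simp [hi]
    rw [hdet, Matrix.det_succ_column_zero, Finset.sum_eq_single 0]
    · simp only [Matrix.of_apply, if_true, Fin.val_zero, pow_zero, one_mul]
      refine mul_nonneg (le_min (hx0 _) (hy0 _)) ?_
      have := ih (fun i => x i.succ - x 0) (fun j => max (y j.succ - x 0) 0)
        (fun a b hab => sub_le_sub_right (hx (Fin.succ_le_succ_iff.2 hab)) _)
        (fun a b hab => max_le_max (sub_le_sub_right (hy (Fin.succ_le_succ_iff.2 hab)) _) le_rfl)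
        (fun i => sub_nonneg.2 (hx (Fin.zero_le _))) (fun i => le_max_right _ _)
      refine this.trans_eq (congrArg Matrix.det ?_)
      ext i j
      have hi : x 0 ≤ x i.succ := hx (Fin.zero_le _)
      simp only [Matrix.submatrix_apply, Matrix.of_apply, Fin.succAbove_zero, Fin.succ_ne_zero,
        if_false]
      rcases le_total (y j.succ) (x 0) with h1 | h1
      · rw [min_eq_right h1, min_eq_right (h1.trans hi), max_eq_right (by linarith),
          min_eq_right (by linarith), sub_self]
      · rw [min_eq_left h1, max_eq_left (by linarith), min_sub_sub_right]
    · intro i _ hi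
      have h2 : y 0 ≤ x i := h.trans (hx (Fin.zero_le _))
      simp [hi, min_eq_right h, min_eq_right h2]
    · simp
  intro k
  induction k with
  | zero => intro x y _ _ _ _; simp
  | succ k ih =>
    intro x y hx hy hx0 hy0
    rcases le_total (y 0) (x 0) with h | h
    · exact key k ih x y hx hy hx0 hy0 h
    · have := key k ih y x hy hx hy0 hx0 h
      rw [← Matrix.det_transpose] at this
      convert this using 2
      ext i j
      simp [min_comm]

/-- A minor of the kernel of minima is again such a kernel, and scaling rows and columns by
nonnegative factors preserves the sign. -/
theorem matTotallyNonneg_of_eq_mul_min {n : ℕ} {C : Matrix (Fin n) (Fin n) ℝ} (h g ρ : Fin n → ℝ)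
    (hh : ∀ i, 0 ≤ h i) (hg : ∀ i, 0 ≤ g i) (hρ : Monotone ρ) (hρ0 : ∀ i, 0 ≤ ρ i)
    (hC : ∀ i j, C i j = h i * (g j * min (ρ i) (ρ j))) : MatTotallyNonneg C := by
  intro k r c hr hc
  have : C.submatrix r c = Matrix.of fun i j => h (r i) *
      (Matrix.of fun i j => g (c j) * (Matrix.of fun i j => min (ρ (r i)) (ρ (c j))) i j) i j := by
    ext i j
    simp [hC]
  rw [this, Matrix.det_mul_column, Matrix.det_mul_row]
  exact mul_nonneg (Finset.prod_nonneg fun i _ => hh _) (mul_nonneg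
    (Finset.prod_nonneg fun i _ => hg _) (det_min_nonneg k _ _ (hρ.comp hr.monotone)
      (hρ.comp hc.monotone) (fun i => hρ0 _) (fun i => hρ0 _)))

/-! ### Tridiagonal inverses and factorization through the diagonal -/

/-- If the parts of a nonsingular matrix above and below the diagonal factor through the index
right after `i`, then row `i` of the inverse vanishes beyond that index. -/
theorem inv_apply_eq_zero_of_factor {n : ℕ} {C : Matrix (Fin n) (Fin n) ℝ} (hC : C.det ≠ 0)
    {i j k : Fin n} (hij : i < j) (hjk : j < k) (hj : C j j ≠ 0)
    (h₁ : ∀ p q, p ≤ j → j ≤ q → C p q * C j j = C p j * C j q)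
    (h₂ : ∀ p q, j ≤ p → q ≤ j → C p q * C j j = C p j * C j q) : C⁻¹ i k = 0 := by
  have hu : IsUnit C.det := hC.isUnit
  -- Row `i` of the inverse is cut into its part `u` beyond `j` and the rest `u'`. By factorization
  -- `u C` is `t` times row `j` of `C` on columns up to `j`, and `u' C` is `-t` times it from `j`
  -- on, where `(u + u') C = e_i` vanishes. Hence `u C` is `t` times row `j` everywhere, so `u = t
  -- e_j`; as `u` vanishes at `j`, it is zero.
  set u : Fin n → ℝ := fun p => if j < p then C⁻¹ i p else 0 with hudef
  set u' : Fin n → ℝ := fun p => if j < p then 0 else C⁻¹ i p with hu'def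
  have hsum : ∀ q, ∑ p, u p * C p q + ∑ p, u' p * C p q = if i = q then 1 else 0 := by
    intro q
    rw [← Finset.sum_add_distrib, ← Matrix.one_apply, ← Matrix.nonsing_inv_mul C hu,
      Matrix.mul_apply]
    refine Finset.sum_congr rfl fun p _ => ?_
    by_cases hp : j < p <;> simp [hudef, hu'def, hp]
  set t : ℝ := (∑ p, u p * C p j) / C j j with ht
  have ht' : (∑ p, u' p * C p j) / C j j = -t := by
    have := hsum j
    rw [if_neg hij.ne] at this
    rw [ht, ← neg_div]; congr 1; linarith
  have hlow : ∀ q, q ≤ j → ∑ p, u p * C p q = t * C j q := by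
    intro q hq
    rw [ht, Finset.sum_div, Finset.sum_mul]
    refine Finset.sum_congr rfl fun p _ => ?_
    by_cases hp : j < p
    · have := h₂ p q hp.le hq
      simp only [hudef, hp, if_true]
      field_simp
      linear_combination C⁻¹ i p * this
    · simp [hudef, hp]
  have hhigh : ∀ q, j ≤ q → ∑ p, u' p * C p q = -t * C j q := by
    intro q hq
    rw [← ht', Finset.sum_div, Finset.sum_mul]
    refine Finset.sum_congr rfl fun p _ => ?_
    by_cases hp : j < p
    · simp [hu'def, hp]
    · have := h₁ p q (not_lt.1 hp) hq
      simp only [hu'def, hp, if_false]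
      field_simp
      linear_combination C⁻¹ i p * this
  have hall : Matrix.vecMul (u - Pi.single j t) C = 0 := by
    ext q
    rw [Matrix.sub_vecMul, Matrix.single_vecMul]
    simp only [Pi.sub_apply, Matrix.vecMul, dotProduct, Pi.zero_apply, Pi.smul_apply,
      Matrix.row_apply, smul_eq_mul]
    rcases le_total q j with hq | hq
    · rw [hlow q hq, sub_self]
    · have := hsum q
      rw [hhigh q hq, if_neg (hij.trans_le hq).ne] at this
      linarith
  have hz := congrFun (Matrix.eq_zero_of_vecMul_eq_zero hC hall) k
  simpa [hudef, hjk, hjk.ne', Pi.single_apply] using hz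

theorem matTridiagonal_inv_of_factor {n : ℕ} {C : Matrix (Fin n) (Fin n) ℝ} (hC : C.det ≠ 0)
    (hd : ∀ j, C j j ≠ 0)
    (h : ∀ i j k, i ≤ j → j ≤ k →
      C i k * C j j = C i j * C j k ∧ C k i * C j j = C k j * C j i) :
    MatTridiagonal C⁻¹ := by
  intro i k hik
  rcases hik with hik | hik
  · exact inv_apply_eq_zero_of_factor (j := ⟨i.val + 1, by omega⟩) hC (Fin.lt_def.2 (by simp))
      (Fin.lt_def.2 hik) (hd _) (fun p q hp hq => (h p _ q hp hq).1)
      (fun p q hp hq => (h q _ p hq hp).2)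
  · have := inv_apply_eq_zero_of_factor (C := C.transpose) (i := k) (k := i)
      (j := ⟨k.val + 1, by omega⟩) (by rwa [Matrix.det_transpose]) (Fin.lt_def.2 (by simp))
      (Fin.lt_def.2 hik) (hd _)
      (fun p q hp hq => by
        simp only [Matrix.transpose_apply]; rw [(h p _ q hp hq).2, mul_comm])
      (fun p q hp hq => by
        simp only [Matrix.transpose_apply]; rw [(h q _ p hq hp).1, mul_comm])
    rwa [← Matrix.transpose_nonsing_inv] at this

/-- If the inverse is tridiagonal, the part above the diagonal factors through each index. -/
theorem factor_of_matTridiagonal_inv {n : ℕ} {C : Matrix (Fin n) (Fin n) ℝ} (hC : C.det ≠ 0)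
    (hT : MatTridiagonal C⁻¹) {i j k : Fin n} (hij : i < j) (hjk : j < k) (hj : C j j ≠ 0) :
    C i k * C j j = C i j * C j k := by
  have hu : IsUnit C.det := hC.isUnit
  -- `z` combines columns `k` and `j` of `C` so as to vanish at `j`; `w` is its part before `j`.
  -- Tridiagonality leaves `C⁻¹ w` supported at `j`, so `w` is a multiple of column `j` of `C`.
  -- Since `w j = 0` and `C j j ≠ 0`, that multiple is zero, and `w i = 0` is the claim.
  set z : Fin n → ℝ := fun p => C j j * C p k - C j k * C p j with hz
  set w : Fin n → ℝ := fun p => if p < j then z p else 0 with hw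
  have hAz : ∀ r, r < j → ∑ p, C⁻¹ r p * z p = 0 := by
    intro r hr
    have h1 : ∀ l, ∑ p, C⁻¹ r p * C p l = if r = l then 1 else 0 := fun l => by
      rw [← Matrix.one_apply, ← Matrix.nonsing_inv_mul C hu, Matrix.mul_apply]
    have h2 : ∑ p, C⁻¹ r p * z p =
        C j j * ∑ p, C⁻¹ r p * C p k - C j k * ∑ p, C⁻¹ r p * C p j := by
      rw [Finset.mul_sum, Finset.mul_sum, ← Finset.sum_sub_distrib]
      exact Finset.sum_congr rfl fun p _ => by rw [hz]; ring
    rw [h2, h1, h1, if_neg hr.ne, if_neg (hr.trans hjk).ne]; simp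
  have hAw : C⁻¹.mulVec w = Pi.single j (∑ p, C⁻¹ j p * w p) := by
    ext r
    rw [Matrix.mulVec, dotProduct]
    rcases lt_trichotomy r j with hr | rfl | hr
    · rw [Pi.single_eq_of_ne hr.ne, ← hAz r hr]
      refine Finset.sum_congr rfl fun p _ => ?_
      rcases lt_trichotomy p j with hp | rfl | hp
      · simp [hw, hp]
      · simp [hw, hz]; right; ring
      · rw [hT r p (Or.inl (by simp only [Fin.lt_def] at *; omega))]; simp
    · simp
    · rw [Pi.single_eq_of_ne hr.ne']
      refine Finset.sum_eq_zero fun p _ => ?_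
      by_cases hp : p < j
      · rw [hT r p (Or.inr (by simp only [Fin.lt_def] at *; omega))]; simp
      · simp [hw, hp]
  have hwC : w = C.mulVec (Pi.single j (∑ p, C⁻¹ j p * w p)) := by
    rw [← hAw, Matrix.mulVec_mulVec, Matrix.mul_nonsing_inv C hu, Matrix.one_mulVec]
  have hs : ∑ p, C⁻¹ j p * w p = 0 := by
    have := congrFun hwC j
    simpa [hw, hj] using this
  have hi := congrFun hwC i
  rw [hs] at hi
  simp only [hw, hz, hij, if_true, Pi.single_zero, Matrix.mulVec_zero, Pi.zero_apply] at hi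
  linarith

/-! ### Row sums of tridiagonal matrices -/

/-- A row of a tridiagonal matrix applied to a vector that is locally constant on the left. -/
theorem MatTridiagonal.row_sum_mul {n : ℕ} {A : Matrix (Fin n) (Fin n) ℝ} (hT : MatTridiagonal A)
    (v : Fin n → ℝ) {i j : Fin n} (hij : i.val + 1 = j.val)
    (hv : ∀ p : Fin n, p.val + 1 = i.val → v p = v i) :
    ∑ p, A i p * v p = (∑ p, A i p) * v i + A i j * (v j - v i) := by
  have : ∑ p, A i p * (v p - v i) = A i j * (v j - v i) := by
    refine Finset.sum_eq_single j (fun p _ hp => ?_) (by simp)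
    have hp' : p.val ≠ j.val := fun h => hp (Fin.ext h)
    by_cases h1 : p.val + 1 = i.val
    · rw [hv p h1]; simp
    by_cases h2 : p = i
    · rw [h2]; simp
    have h2' : p.val ≠ i.val := fun h => h2 (Fin.ext h)
    rw [hT i p (by omega), zero_mul]
  rw [← this, Finset.sum_mul, ← Finset.sum_add_distrib]
  exact Finset.sum_congr rfl fun p _ => by ring

theorem MatTridiagonal.row_sum_mul_last {n : ℕ} {A : Matrix (Fin n) (Fin n) ℝ}
    (hT : MatTridiagonal A) (v : Fin n → ℝ) {i : Fin n} (hi : i.val + 1 = n)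
    (hv : ∀ p : Fin n, p.val + 1 = i.val → v p = v i) :
    ∑ p, A i p * v p = (∑ p, A i p) * v i := by
  rw [Finset.sum_mul]
  refine Finset.sum_congr rfl fun p _ => ?_
  by_cases h1 : p.val + 1 = i.val
  · rw [hv p h1]
  by_cases h2 : p = i
  · rw [h2]
  have h2' : p.val ≠ i.val := fun h => h2 (Fin.ext h)
  rw [hT i p (by omega)]; simp

/-- A vector is constant on an initial segment where a tridiagonal matrix with vanishing row sums
annihilates it. -/
theorem MatTridiagonal.eq_of_annihilated {n : ℕ} {A : Matrix (Fin n) (Fin n) ℝ}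
    (hT : MatTridiagonal A) (v : Fin n → ℝ) {p : Fin n}
    (hA : ∀ i j : Fin n, i.val + 1 = j.val → A i j ≠ 0) (hs : ∀ i, i < p → ∑ j, A i j = 0)
    (hv : ∀ i, i < p → ∑ j, A i j * v j = 0) : ∀ i, i ≤ p → v i = v p := by
  -- The first row has no left neighbour, so its equation already equates the first two values; each
  -- later row uses the equality just obtained.
  have step : ∀ k : ℕ, ∀ i j : Fin n, i.val = k → i.val + 1 = j.val → j ≤ p → v i = v j := by
    intro k
    induction k with
    | zero =>
      intro i j hi hij hj
      have hip : i < p := by simp only [Fin.lt_def, Fin.le_def] at *; omega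
      have := hT.row_sum_mul v hij (fun p hp => by omega)
      rw [hv i hip, hs i hip, zero_mul, zero_add, eq_comm, mul_eq_zero] at this
      linarith [this.resolve_left (hA i j hij)]
    | succ k ih =>
      intro i j hi hij hj
      have hip : i < p := by simp only [Fin.lt_def, Fin.le_def] at *; omega
      have := hT.row_sum_mul v hij (fun q hq => ih q i (by omega) hq hip.le)
      rw [hv i hip, hs i hip, zero_mul, zero_add, eq_comm, mul_eq_zero] at this
      linarith [this.resolve_left (hA i j hij)]
  have main : ∀ d : ℕ, ∀ i : Fin n, i.val + d = p.val → v i = v p := by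
    intro d
    induction d with
    | zero => intro i hi; congr 1; exact Fin.ext hi
    | succ d ih =>
      intro i hi
      rw [step _ i ⟨i.val + 1, by omega⟩ rfl rfl (Fin.le_def.2 (by simp; omega))]
      exact ih _ (by simp; omega)
  intro i hi
  exact main (p.val - i.val) i (by simp only [Fin.le_def] at hi; omega)

/-! ### Irreducibility of tridiagonal matrices -/

theorem exists_edge_of_reflTransGen {α : Type*} {r : α → α → Prop} (P : α → Prop) {a b : α}
    (h : Relation.ReflTransGen r a b) (ha : P a) (hb : ¬ P b) : ∃ p q, P p ∧ ¬ P q ∧ r p q := by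
  induction h with
  | refl => exact absurd ha hb
  | @tail c d _ hcd ih =>
    by_cases hc : P c
    · exact ⟨c, d, hc, hb, hcd⟩
    · exact ih hc

/-- A path from `i` to `j` has to leave the initial segment ending at `i`, and the only arc that can
do so is `i → j`; the reverse path is treated alike. -/
theorem MatIrreducible.apply_ne_zero_of_matTridiagonal {n : ℕ} {A : Matrix (Fin n) (Fin n) ℝ}
    (hI : MatIrreducible A) (hT : MatTridiagonal A) {i j : Fin n} (hij : i.val + 1 = j.val) :
    A i j ≠ 0 ∧ A j i ≠ 0 := by
  constructor
  · obtain ⟨p, q, hp, hq, hpq⟩ := exists_edge_of_reflTransGen (fun p => p ≤ i) (hI i j) le_rfl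
      (by simp only [Fin.le_def]; omega)
    simp only [Fin.le_def] at hp hq
    have h : p.val = i.val ∧ q.val = j.val := by
      by_contra hne
      exact hpq (hT p q (by omega))
    rwa [Fin.ext h.1, Fin.ext h.2] at hpq
  · obtain ⟨p, q, hp, hq, hpq⟩ := exists_edge_of_reflTransGen (fun p => j ≤ p) (hI j i) le_rfl
      (by simp only [Fin.le_def]; omega)
    simp only [Fin.le_def] at hp hq
    have h : p.val = j.val ∧ q.val = i.val := by
      by_contra hne
      exact hpq (hT p q (by omega))
    rwa [Fin.ext h.1, Fin.ext h.2] at hpq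

theorem matIrreducible_of_adjacent_ne_zero {n : ℕ} {A : Matrix (Fin n) (Fin n) ℝ}
    (h : ∀ i j : Fin n, i.val + 1 = j.val → A i j ≠ 0 ∧ A j i ≠ 0) : MatIrreducible A := by
  have main : ∀ d : ℕ, ∀ i j : Fin n, i.val + d = j.val →
      Relation.ReflTransGen (fun p q : Fin n => A p q ≠ 0) i j ∧
      Relation.ReflTransGen (fun p q : Fin n => A p q ≠ 0) j i := by
    intro d
    induction d with
    | zero => intro i j hij; rw [Fin.ext hij]; exact ⟨.refl, .refl⟩
    | succ d ih =>
      intro i j hij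
      have h1 := ih ⟨i.val + 1, by omega⟩ j (by simp; omega)
      have h2 := h i ⟨i.val + 1, by omega⟩ rfl
      exact ⟨.head h2.1 h1.1, .tail h1.2 h2.2⟩
  intro i j
  rcases le_total i j with hij | hij
  · exact (main (j.val - i.val) i j (by simp only [Fin.le_def] at hij; omega)).1
  · exact (main (i.val - j.val) j i (by simp only [Fin.le_def] at hij; omega)).2

/-! ### M-matrices and diagonal dominance -/

/-- Diagonal entries of an M-matrix are nonnegative. -/
theorem MatIsM.diag_nonneg {n : ℕ} {A : Matrix (Fin n) (Fin n) ℝ} (h : MatIsM A) (i : Fin n) :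
    0 ≤ A i i := by
  obtain ⟨t, B, hB, ht, hρ, rfl⟩ := h
  -- Gelfand's formula: `(B i i) ^ k ≤ (B ^ k) i i ≤ ‖M ^ k‖` for nonnegative `B`, and taking `k`-th
  -- roots gives `B i i ≤ ρ(B) ≤ t`.
  let _ := Matrix.linftyOpNormedRing (n := Fin n) (α := ℂ)
  let _ := Matrix.linftyOpNormedAlgebra (n := Fin n) (R := ℂ) (α := ℂ)
  set M : Matrix (Fin n) (Fin n) ℂ := B.map (fun x : ℝ => (x : ℂ)) with hM
  have hpow0 : ∀ k : ℕ, ∀ p q, 0 ≤ (B ^ k) p q := by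
    intro k
    induction k with
    | zero => intro p q; rw [pow_zero, Matrix.one_apply]; split_ifs <;> simp
    | succ k ih =>
      intro p q
      rw [pow_succ, Matrix.mul_apply]
      exact Finset.sum_nonneg fun r _ => mul_nonneg (ih _ _) (hB _ _)
  have hpow : ∀ k : ℕ, (B i i) ^ k ≤ (B ^ k) i i := by
    intro k
    induction k with
    | zero => simp
    | succ k ih =>
      rw [pow_succ, pow_succ, Matrix.mul_apply]
      exact (mul_le_mul_of_nonneg_right ih (hB _ _)).trans (Finset.single_le_sum
        (f := fun r => (B ^ k) i r * B r i)
        (fun r _ => mul_nonneg (hpow0 _ _ _) (hB _ _)) (Finset.mem_univ i))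
  have hMpow : ∀ k : ℕ, M ^ k = (B ^ k).map (fun x : ℝ => (x : ℂ)) := by
    intro k
    exact (map_pow Complex.ofRealHom.mapMatrix B k).symm
  have hnorm : ∀ k : ℕ, (B i i).toNNReal ^ k ≤ ‖M ^ k‖₊ := by
    intro k
    have h1 : ‖(M ^ k) i i‖₊ ≤ ‖M ^ k‖₊ := by
      rw [Matrix.linfty_opNNNorm_def]
      exact (Finset.single_le_sum (f := fun j => ‖(M ^ k) i j‖₊) (fun _ _ => zero_le)
        (Finset.mem_univ i)).trans
        (Finset.le_sup (f := fun i => ∑ j, ‖(M ^ k) i j‖₊) (Finset.mem_univ i))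
    refine le_trans ?_ h1
    rw [← NNReal.coe_le_coe, hMpow]
    simp only [NNReal.coe_pow, Real.coe_toNNReal _ (hB i i), coe_nnnorm, Matrix.map_apply,
      Complex.norm_real, Real.norm_eq_abs]
    exact (hpow k).trans (le_abs_self _)
  have hlim := spectrum.pow_nnnorm_pow_one_div_tendsto_nhds_spectralRadius M
  have hle : ((B i i).toNNReal : ENNReal) ≤ spectralRadius ℂ M := by
    refine ge_of_tendsto hlim ?_
    filter_upwards [Filter.eventually_gt_atTop 0] with k hk
    have h2 : ((B i i).toNNReal : ENNReal) ^ k ≤ ‖M ^ k‖₊ := by exact_mod_cast hnorm k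
    calc ((B i i).toNNReal : ENNReal) = (((B i i).toNNReal : ENNReal) ^ k) ^ (1 / k : ℝ) := by
          rw [← ENNReal.rpow_natCast, ← ENNReal.rpow_mul, mul_one_div_cancel (by positivity),
            ENNReal.rpow_one]
      _ ≤ _ := ENNReal.rpow_le_rpow h2 (by positivity)
  have h3 := hle.trans hρ
  rw [ENNReal.ofReal, ENNReal.coe_le_coe, Real.toNNReal_le_toNNReal_iff ht] at h3
  simpa using h3

theorem MatIsM.apply_nonpos {n : ℕ} {A : Matrix (Fin n) (Fin n) ℝ} (h : MatIsM A) {i j : Fin n}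
    (hij : i ≠ j) : A i j ≤ 0 := by
  obtain ⟨t, B, hB, ht, hρ, rfl⟩ := h
  simpa [hij] using hB i j

/-- A matrix with nonpositive off-diagonal entries and nonnegative row sums is an M-matrix. -/
theorem matIsM_of_row_sum_nonneg {n : ℕ} {A : Matrix (Fin n) (Fin n) ℝ}
    (ho : ∀ i j, i ≠ j → A i j ≤ 0) (hs : ∀ i, 0 ≤ ∑ j, A i j) : MatIsM A := by
  have hd : ∀ i, 0 ≤ A i i := by
    intro i
    have := hs i
    rw [← Finset.add_sum_erase _ _ (Finset.mem_univ i)] at this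
    have h2 : ∑ j ∈ Finset.univ.erase i, A i j ≤ 0 :=
      Finset.sum_nonpos fun j hj => ho i j (Finset.ne_of_mem_erase hj).symm
    linarith
  -- The trace dominates every diagonal entry, so `t • 1 - A` is nonnegative. Its row sums are `t`
  -- minus those of `A`, so its maximal row sum norm, and with it the spectral radius, is at most
  -- `t`.
  set t : ℝ := ∑ i, A i i with ht
  have hB : ∀ i j, 0 ≤ (t • (1 : Matrix (Fin n) (Fin n) ℝ) - A) i j := by
    intro i j
    by_cases hij : i = j
    · subst hij
      have : A i i ≤ t := Finset.single_le_sum (f := fun i => A i i) (fun i _ => hd i)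
        (Finset.mem_univ i)
      simpa using this
    · simpa [hij] using ho i j hij
  have ht0 : 0 ≤ t := Finset.sum_nonneg fun i _ => hd i
  refine ⟨t, t • 1 - A, hB, ht0, ?_, by simp⟩
  let _ := Matrix.linftyOpNormedRing (n := Fin n) (α := ℂ)
  let _ := Matrix.linftyOpNormedAlgebra (n := Fin n) (R := ℂ) (α := ℂ)
  rcases isEmpty_or_nonempty (Fin n) with he | he
  · have : Subsingleton (Matrix (Fin n) (Fin n) ℂ) := inferInstance
    simp [spectralRadius, spectrum.of_subsingleton]
  refine (spectrum.spectralRadius_le_nnnorm _).trans ?_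
  rw [ENNReal.ofReal, ENNReal.coe_le_coe, Matrix.linfty_opNNNorm_def]
  refine Finset.sup_le fun i _ => ?_
  rw [← NNReal.coe_le_coe, Real.coe_toNNReal _ ht0, NNReal.coe_sum]
  have : ∀ j, (‖(t • (1 : Matrix (Fin n) (Fin n) ℝ) - A).map (fun x : ℝ => (x : ℂ)) i j‖₊ : ℝ) =
      t * (1 : Matrix (Fin n) (Fin n) ℝ) i j - A i j := by
    intro j
    rw [coe_nnnorm, Matrix.map_apply, Complex.norm_real, Real.norm_eq_abs, abs_of_nonneg (hB i j)]
    simp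
  rw [Finset.sum_congr rfl fun j _ => this j, Finset.sum_sub_distrib, ← Finset.mul_sum]
  simp only [Matrix.one_apply, Finset.sum_ite_eq, Finset.mem_univ, if_true, mul_one]
  linarith [hs i]

theorem matRowDominant_of_row_sum_nonneg {n : ℕ} {A : Matrix (Fin n) (Fin n) ℝ}
    (ho : ∀ i j, i ≠ j → A i j ≤ 0) (hs : ∀ i, 0 ≤ ∑ j, A i j) : MatRowDominant A := by
  intro i
  have := hs i
  rw [← Finset.add_sum_erase _ _ (Finset.mem_univ i)] at this
  have h2 : ∑ j ∈ Finset.univ.erase i, |A i j| = -∑ j ∈ Finset.univ.erase i, A i j := by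
    rw [← Finset.sum_neg_distrib]
    exact Finset.sum_congr rfl fun j hj => abs_of_nonpos (ho i j (Finset.ne_of_mem_erase hj).symm)
  rw [h2]
  exact le_trans (by linarith) (le_abs_self _)

theorem MatRowDominant.row_sum_nonneg {n : ℕ} {A : Matrix (Fin n) (Fin n) ℝ}
    (h : MatRowDominant A) {i : Fin n} (hd : 0 ≤ A i i) : 0 ≤ ∑ j, A i j := by
  rw [← Finset.add_sum_erase _ _ (Finset.mem_univ i)]
  have h1 := h i
  rw [abs_of_nonneg hd] at h1
  have h2 := (neg_abs_le _).trans' (neg_le_neg (Finset.abs_sum_le_sum_abs (fun j => A i j)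
    (Finset.univ.erase i)))
  linarith

/-! ### Cyclops matrices: entries, ultrametricity, total nonnegativity -/

/-- The entries of a cyclops with eye `m+` whose diagonal entries dominate the positive values
`b₁`, `b₂` of the off-diagonal blocks. -/
structure CyclopsForm {n : ℕ} (m : ℕ) (b₁ b₂ : ℝ) (C : Matrix (Fin n) (Fin n) ℝ) : Prop where
  top : ∀ i j : Fin n, i ≤ j → j.val < m → C i j = C j j ∧ C j i = C j j
  bot : ∀ i j : Fin n, i ≤ j → m ≤ i.val → C i j = C i i ∧ C j i = C i i
  off : ∀ i j : Fin n, i.val < m → m ≤ j.val → C i j = b₁ ∧ C j i = b₂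
  anti : ∀ i j : Fin n, i < j → j.val < m → C j j < C i i
  mono : ∀ i j : Fin n, i < j → m ≤ i.val → C i i < C j j
  le : ∀ i, b₁ ≤ C i i ∧ b₂ ≤ C i i
  pos₁ : 0 < b₁
  pos₂ : 0 < b₂

namespace CyclopsForm

variable {n m : ℕ} {b₁ b₂ : ℝ} {C : Matrix (Fin n) (Fin n) ℝ}

theorem transpose (h : CyclopsForm m b₁ b₂ C) : CyclopsForm m b₂ b₁ C.transpose where
  top i j hij hj := (h.top i j hij hj).symm
  bot i j hij hi := (h.bot i j hij hi).symm
  off i j hi hj := (h.off i j hi hj).symm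
  anti := h.anti
  mono := h.mono
  le i := (h.le i).symm
  pos₁ := h.pos₂
  pos₂ := h.pos₁

theorem rev (h : CyclopsForm m b₁ b₂ C) (hm : m ≤ n) :
    CyclopsForm (n - m) b₂ b₁ (C.submatrix Fin.rev Fin.rev) where
  top i j hij hj :=
    (h.bot j.rev i.rev (Fin.rev_le_rev.2 hij) (by simp only [Fin.val_rev]; omega)).symm
  bot i j hij hi :=
    (h.top j.rev i.rev (Fin.rev_le_rev.2 hij) (by simp only [Fin.val_rev]; omega)).symm
  off i j hi hj := (h.off j.rev i.rev (by simp only [Fin.val_rev]; omega)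
    (by simp only [Fin.val_rev]; omega)).symm
  anti i j hij hj := h.mono j.rev i.rev (Fin.rev_lt_rev.2 hij) (by simp only [Fin.val_rev]; omega)
  mono i j hij hi := h.anti j.rev i.rev (Fin.rev_lt_rev.2 hij) (by simp only [Fin.val_rev]; omega)
  le i := (h.le i.rev).symm
  pos₁ := h.pos₂
  pos₂ := h.pos₁

theorem diag_pos (h : CyclopsForm m b₁ b₂ C) (i : Fin n) : 0 < C i i := h.pos₁.trans_le (h.le i).1

/-- If `j` lies in the leading block, rows `i` and `j` agree from column `j` on; if it lies in the
trailing block, columns `j` and `k` agree down to row `j`. The same holds for the transpose. -/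
theorem factor (h : CyclopsForm m b₁ b₂ C) {i j k : Fin n} (hij : i ≤ j) (hjk : j ≤ k) :
    C i k * C j j = C i j * C j k ∧ C k i * C j j = C k j * C j i := by
  have hij' := Fin.le_def.1 hij
  have hjk' := Fin.le_def.1 hjk
  by_cases hj : j.val < m
  · obtain ⟨h1, h2⟩ := h.top i j hij hj
    by_cases hk : k.val < m
    · obtain ⟨h3, h4⟩ := h.top i k (hij.trans hjk) hk
      obtain ⟨h5, h6⟩ := h.top j k hjk hk
      rw [h1, h2, h3, h4, h5, h6]; exact ⟨mul_comm _ _, rfl⟩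
    · obtain ⟨h3, h4⟩ := h.off i k (by omega) (by omega)
      obtain ⟨h5, h6⟩ := h.off j k (by omega) (by omega)
      rw [h1, h2, h3, h4, h5, h6]; exact ⟨mul_comm _ _, rfl⟩
  · obtain ⟨h1, h2⟩ := h.bot j k hjk (by omega)
    by_cases hi : i.val < m
    · obtain ⟨h3, h4⟩ := h.off i k (by omega) (by omega)
      obtain ⟨h5, h6⟩ := h.off i j (by omega) (by omega)
      rw [h1, h2, h3, h4, h5, h6]; exact ⟨rfl, mul_comm _ _⟩
    · obtain ⟨h3, h4⟩ := h.bot i j hij (by omega)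
      obtain ⟨h5, h6⟩ := h.bot i k (hij.trans hjk) (by omega)
      rw [h1, h2, h3, h4, h5, h6]; exact ⟨rfl, mul_comm _ _⟩

theorem matTridiagonal_inv (h : CyclopsForm m b₁ b₂ C) (hC : C.det ≠ 0) : MatTridiagonal C⁻¹ :=
  matTridiagonal_inv_of_factor hC (fun j => (h.diag_pos j).ne') fun _ _ _ hij hjk =>
    h.factor hij hjk

theorem diag_anti (h : CyclopsForm m b₁ b₂ C) {i j : Fin n} (hij : i ≤ j) (hj : j.val < m) :
    C j j ≤ C i i := by
  rcases hij.eq_or_lt with rfl | hlt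
  · exact le_rfl
  · exact (h.anti i j hlt hj).le

theorem diag_mono (h : CyclopsForm m b₁ b₂ C) {i j : Fin n} (hij : i ≤ j) (hi : m ≤ i.val) :
    C i i ≤ C j j := by
  rcases hij.eq_or_lt with rfl | hlt
  · exact le_rfl
  · exact (h.mono i j hlt hi).le

theorem apply_of_le (h : CyclopsForm m b₁ b₂ C) {i j : Fin n} (hij : i ≤ j) :
    (0 < C i j ∧ 0 < C j i) ∧ (C i j ≤ C i i ∧ C j i ≤ C i i) ∧ C i j ≤ C j j ∧ C j i ≤ C j j := by
  have hij' := Fin.le_def.1 hij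
  by_cases hj : j.val < m
  · obtain ⟨h1, h2⟩ := h.top i j hij hj
    rw [h1, h2]
    have := h.diag_pos j
    have := h.diag_anti hij hj
    simp [*]
  · by_cases hi : i.val < m
    · obtain ⟨h1, h2⟩ := h.off i j hi (by omega)
      rw [h1, h2]
      exact ⟨⟨h.pos₁, h.pos₂⟩, h.le i, h.le j⟩
    · obtain ⟨h1, h2⟩ := h.bot i j hij (by omega)
      rw [h1, h2]
      have := h.diag_pos i
      have := h.diag_mono hij (by omega)
      simp [*]

theorem pos (h : CyclopsForm m b₁ b₂ C) (i j : Fin n) : 0 < C i j := by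
  rcases le_total i j with hij | hij
  · exact (h.apply_of_le hij).1.1
  · exact (h.apply_of_le hij).1.2

theorem matIrreducible (h : CyclopsForm m b₁ b₂ C) : MatIrreducible C :=
  fun i j => .single (h.pos i j).ne'

end CyclopsForm

theorem exists_sorted_of_card_eq_three {n : ℕ} {S : Finset (Fin n)} (hS : S.card = 3) :
    ∃ i j k : Fin n, i < j ∧ j < k ∧ S = {i, j, k} := by
  refine ⟨S.orderEmbOfFin hS 0, S.orderEmbOfFin hS 1, S.orderEmbOfFin hS 2,
    (S.orderEmbOfFin hS).strictMono (by decide), (S.orderEmbOfFin hS).strictMono (by decide), ?_⟩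
  ext x
  have hx : x ∈ S ↔ ∃ a, S.orderEmbOfFin hS a = x := by
    rw [← Finset.mem_coe, ← Finset.range_orderEmbOfFin S hS, Set.mem_range]
  rw [hx, Fin.exists_fin_succ, Fin.exists_fin_two]
  simp [eq_comm]

/-- For a sorted triple the distinguished index is the largest if the middle one is in the leading
block, and the smallest otherwise. -/
theorem CyclopsForm.matGenUltrametric {n m : ℕ} {b₁ b₂ : ℝ} {C : Matrix (Fin n) (Fin n) ℝ}
    (h : CyclopsForm m b₁ b₂ C) : MatGenUltrametric C where
  nonneg i j := (h.pos i j).le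
  diag i j := by
    rcases le_total i j with hij | hij
    · exact max_le (h.apply_of_le hij).2.1.1 (h.apply_of_le hij).2.1.2
    · exact max_le (h.apply_of_le hij).2.2.2 (h.apply_of_le hij).2.2.1
  triple S hS := by
    obtain ⟨i, j, k, hij, hjk, rfl⟩ := exists_sorted_of_card_eq_three hS
    have hij' := Fin.lt_def.1 hij
    have hjk' := Fin.lt_def.1 hjk
    by_cases hj : j.val < m
    · refine ⟨k, j, i, by ext; simp; tauto, ?_⟩
      obtain ⟨h1, h2⟩ := h.top i j hij.le hj
      rw [h1, h2]
      by_cases hk : k.val < m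
      · obtain ⟨h3, h4⟩ := h.top i k (hij.trans hjk).le hk
        obtain ⟨h5, h6⟩ := h.top j k hjk.le hk
        rw [h3, h4, h5, h6]
        have := h.diag_anti hjk.le hk
        simp [*]
      · obtain ⟨h3, h4⟩ := h.off i k (by omega) (by omega)
        obtain ⟨h5, h6⟩ := h.off j k (by omega) (by omega)
        rw [h3, h4, h5, h6]
        have := h.le j
        simp [*]
    · refine ⟨i, j, k, rfl, ?_⟩
      obtain ⟨h1, h2⟩ := h.bot j k hjk.le (by omega)
      rw [h1, h2]
      by_cases hi : i.val < m
      · obtain ⟨h3, h4⟩ := h.off i k (by omega) (by omega)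
        obtain ⟨h5, h6⟩ := h.off i j (by omega) (by omega)
        rw [h3, h4, h5, h6]
        have := h.le j
        simp [*]
      · obtain ⟨h3, h4⟩ := h.bot i k (hij.trans hjk).le (by omega)
        obtain ⟨h5, h6⟩ := h.bot i j hij.le (by omega)
        rw [h3, h4, h5, h6]
        have := h.diag_mono hij.le (by omega)
        simp [*]

theorem CyclopsForm.matTotallyNonneg {n m : ℕ} {b₁ b₂ : ℝ} {C : Matrix (Fin n) (Fin n) ℝ}
    (h : CyclopsForm m b₁ b₂ C) : MatTotallyNonneg C := by
  have hb₁ := h.pos₁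
  have hb₂ := h.pos₂
  have hd := h.diag_pos
  -- Normalized so that the row factors `C i i`, `b₂` and column factors `C i i`, `b₁` reproduce all
  -- four blocks. Across the eye, `ρ` is monotone because `b₁ * b₂ ≤ C i i * C j j`.
  set ρ : Fin n → ℝ := fun i => if i.val < m then (C i i)⁻¹ else C i i / (b₁ * b₂) with hρ
  have hmono : Monotone ρ := by
    intro i j hij
    have hij' := Fin.le_def.1 hij
    simp only [hρ]
    split_ifs with hi hj hj
    · exact inv_anti₀ (hd j) (h.diag_anti hij hj)
    · rw [inv_eq_one_div, div_le_div_iff₀ (hd i) (mul_pos hb₁ hb₂), one_mul, mul_comm (C j j)]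
      exact mul_le_mul (h.le i).1 (h.le j).2 hb₂.le (hd i).le
    · omega
    · exact div_le_div_of_nonneg_right (h.diag_mono hij (by omega)) (mul_pos hb₁ hb₂).le
  refine matTotallyNonneg_of_eq_mul_min (fun i => if i.val < m then C i i else b₂)
    (fun i => if i.val < m then C i i else b₁) ρ ?_ ?_ hmono ?_ ?_
  · intro i; split_ifs
    exacts [(hd i).le, hb₂.le]
  · intro i; split_ifs
    exacts [(hd i).le, hb₁.le]
  · intro i; simp only [hρ]; split_ifs
    · exact (inv_pos.2 (hd i)).le
    · exact (div_pos (hd i) (mul_pos hb₁ hb₂)).le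
  · intro i j
    rcases le_total i j with hij | hij
    · have hij' := Fin.le_def.1 hij
      rw [min_eq_left (hmono hij)]
      have := (hd i).ne'
      simp only [hρ]
      split_ifs with hi hj hj
      · rw [(h.top i j hij hj).1]; field_simp
      · rw [(h.off i j hi (by omega)).1]; field_simp
      · omega
      · rw [(h.bot i j hij (by omega)).1]; field_simp
    · have hij' := Fin.le_def.1 hij
      rw [min_eq_right (hmono hij)]
      have := (hd j).ne'
      simp only [hρ]
      split_ifs with hi hj hj
      · rw [(h.top j i hij hi).2]; field_simp
      · omega
      · rw [(h.off j i (by omega) (by omega)).2]; field_simp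
      · rw [(h.bot j i hij (by omega)).2]; field_simp

/-- The parameters number `m` and `m + 1` are the least of their blocks, so bounding them bounds the
whole diagonal. -/
theorem MatCyclops.cyclopsForm {n m : ℕ} {hm : m ≤ n} {a : Fin n → ℝ} {b₁ b₂ : ℝ}
    {C : Matrix (Fin n) (Fin n) ℝ} (h : MatCyclops m hm a b₁ b₂ C) (hm1 : 1 ≤ m)
    (hle : ∀ i : Fin n, i.val + 1 = m ∨ i.val + 1 = m + 1 → max b₁ b₂ ≤ a i)
    (hpos : 0 < min b₁ b₂) : CyclopsForm m b₁ b₂ C := by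
  obtain ⟨⟨hanti, hT⟩, ⟨hmono, hB⟩, h₁, h₂⟩ := h
  have hT' : ∀ i j : Fin n, i ≤ j → j.val < m → C i j = a j ∧ C j i = a j := by
    intro i j hij hj
    have hij' := Fin.le_def.1 hij
    have e1 := hT (Fin.rev ⟨i, by omega⟩) (Fin.rev ⟨j, hj⟩)
    have e2 := hT (Fin.rev ⟨j, hj⟩) (Fin.rev ⟨i, by omega⟩)
    simp only [Matrix.submatrix_apply, Fin.rev_rev, Fin.rev_le_rev, Fin.mk_le_mk] at e1 e2
    rw [if_pos hij'] at e2
    refine ⟨?_, e2⟩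
    split_ifs at e1 with hc
    · have : i = j := le_antisymm hij (Fin.le_def.2 hc)
      subst this; exact e1
    · exact e1
  have hB' : ∀ i j : Fin n, i ≤ j → m ≤ i.val → C i j = a i ∧ C j i = a i := by
    intro i j hij hi
    have hij' := Fin.le_def.1 hij
    have e1 := hB ⟨i - m, by omega⟩ ⟨j - m, by omega⟩
    have e2 := hB ⟨j - m, by omega⟩ ⟨i - m, by omega⟩
    simp only [Matrix.submatrix_apply, Fin.mk_le_mk, Nat.add_sub_cancel' hi,
      Nat.add_sub_cancel' (hi.trans hij')] at e1 e2
    rw [if_pos (by omega)] at e1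
    refine ⟨e1, ?_⟩
    split_ifs at e2 with hc
    · have : i = j := Fin.ext (by omega)
      subst this; exact e2
    · exact e2
  have hd : ∀ i, C i i = a i := by
    intro i
    by_cases hi : i.val < m
    · exact (hT' i i le_rfl hi).1
    · exact (hB' i i le_rfl (by omega)).1
  have ha : ∀ i j : Fin n, i < j → j.val < m → a j < a i := by
    intro i j hij hj
    have hij' := Fin.lt_def.1 hij
    have := @hanti (Fin.rev ⟨j, hj⟩) (Fin.rev ⟨i, by omega⟩)
      (Fin.rev_lt_rev.2 (Fin.mk_lt_mk.2 hij'))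
    simpa using this
  have hb : ∀ i j : Fin n, i < j → m ≤ i.val → a i < a j := by
    intro i j hij hi
    have hij' := Fin.lt_def.1 hij
    have := @hmono ⟨i - m, by omega⟩ ⟨j - m, by omega⟩ (Fin.mk_lt_mk.2 (by omega))
    simpa only [Nat.add_sub_cancel' hi, Nat.add_sub_cancel' (hi.trans hij'.le)] using this
  have hmax : ∀ i, max b₁ b₂ ≤ a i := by
    intro i
    by_cases hi : i.val < m
    · refine (hle ⟨m - 1, by omega⟩ (Or.inl (by simp; omega))).trans ?_
      by_cases hi' : i.val = m - 1
      · exact le_of_eq (congrArg a (Fin.ext hi'.symm))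
      · exact (ha i _ (Fin.lt_def.2 (by simp; omega)) (by simp; omega)).le
    · refine (hle ⟨m, by omega⟩ (Or.inr rfl)).trans ?_
      by_cases hi' : i.val = m
      · exact le_of_eq (congrArg a (Fin.ext hi'.symm))
      · exact (hb _ i (Fin.lt_def.2 (by simp; omega)) le_rfl).le
  refine ⟨?_, ?_, ?_, ?_, ?_, ?_, (lt_min_iff.1 hpos).1, (lt_min_iff.1 hpos).2⟩
  · intro i j; rw [hd]; exact hT' i j
  · intro i j; rw [hd]; exact hB' i j
  · intro i j hi hj
    have e1 := h₁ ⟨i, hi⟩ ⟨j - m, by omega⟩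
    have e2 := h₂ ⟨j - m, by omega⟩ ⟨i, hi⟩
    simp only [Nat.add_sub_cancel' hj] at e1 e2
    exact ⟨e1, e2⟩
  · intro i j; rw [hd, hd]; exact ha i j
  · intro i j; rw [hd, hd]; exact hb i j
  · intro i; rw [hd]; exact max_le_iff.1 (hmax i)

theorem CyclopsForm.matCyclops {n m : ℕ} {b₁ b₂ : ℝ} {C : Matrix (Fin n) (Fin n) ℝ}
    (h : CyclopsForm m b₁ b₂ C) (hm : m ≤ n) : MatCyclops m hm (fun i => C i i) b₁ b₂ C := by
  refine ⟨⟨?_, ?_⟩, ⟨?_, ?_⟩, ?_, ?_⟩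
  · intro i j hij
    have := Fin.rev_lt_rev.2 hij
    exact h.anti _ _ (Fin.mk_lt_mk.2 (Fin.lt_def.1 this)) i.rev.isLt
  · intro i j
    simp only [Matrix.submatrix_apply]
    split_ifs with hij
    · exact (h.top _ _ (Fin.mk_le_mk.2 (Fin.le_def.1 (Fin.rev_le_rev.2 hij))) i.rev.isLt).2
    · exact (h.top _ _ (Fin.mk_le_mk.2 (Fin.le_def.1 (Fin.rev_le_rev.2 (le_of_not_ge hij))))
        j.rev.isLt).1
  · intro i j hij
    exact h.mono _ _ (Fin.mk_lt_mk.2 (by have := Fin.lt_def.1 hij; omega)) (by simp)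
  · intro i j
    simp only [Matrix.submatrix_apply]
    split_ifs with hij
    · exact (h.bot _ _ (Fin.mk_le_mk.2 (by have := Fin.le_def.1 hij; omega)) (by simp)).1
    · exact (h.bot _ _ (Fin.mk_le_mk.2 (by have := Fin.le_def.1 (le_of_not_ge hij); omega))
        (by simp)).2
  · intro i j
    exact (h.off _ _ i.isLt (by simp)).1
  · intro i j
    exact (h.off _ _ j.isLt (by simp)).2

/-! ### From ultrametric triples to a cyclops -/

/-- `i` is a labeling apex of the triple `{i, j, k}` in a generalized ultrametric matrix. -/
def UltrametricApex {n : ℕ} (C : Matrix (Fin n) (Fin n) ℝ) (i j k : Fin n) : Prop :=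
  C i j = C i k ∧ C j i = C k i ∧
    min (C j i) (C i j) ≤ min (C j k) (C k j) ∧ max (C j i) (C i j) ≤ max (C j k) (C k j)

theorem UltrametricApex.swap {n : ℕ} {C : Matrix (Fin n) (Fin n) ℝ} {i j k : Fin n}
    (h : UltrametricApex C i j k) : UltrametricApex C i k j := by
  obtain ⟨h1, h2, h3, h4⟩ := h
  refine ⟨h1.symm, h2.symm, ?_, ?_⟩
  · rw [← h1, ← h2, min_comm (C k j)]; exact h3
  · rw [← h1, ← h2, max_comm (C k j)]; exact h4

/-- The condition is symmetric in the last two labels by `UltrametricApex.swap`, so three cases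
remain out of six labelings. -/
theorem MatGenUltrametric.apex {n : ℕ} {C : Matrix (Fin n) (Fin n) ℝ} (h : MatGenUltrametric C)
    {x y z : Fin n} (hxy : x ≠ y) (hyz : y ≠ z) (hxz : x ≠ z) :
    UltrametricApex C x y z ∨ UltrametricApex C y x z ∨ UltrametricApex C z x y := by
  have hcard : ({x, y, z} : Finset (Fin n)).card = 3 := Finset.card_eq_three.2
    ⟨x, y, z, hxy, hxz, hyz, rfl⟩
  obtain ⟨i, j, k, hS, hU⟩ := h.triple _ hcard
  have hU : UltrametricApex C i j k := hU
  have hx : x = i ∨ x = j ∨ x = k := by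
    have : x ∈ ({i, j, k} : Finset (Fin n)) := hS ▸ by simp
    simpa using this
  have hy : y = i ∨ y = j ∨ y = k := by
    have : y ∈ ({i, j, k} : Finset (Fin n)) := hS ▸ by simp
    simpa using this
  have hz : z = i ∨ z = j ∨ z = k := by
    have : z ∈ ({i, j, k} : Finset (Fin n)) := hS ▸ by simp
    simpa using this
  have hU' := hU.swap
  clear hS hcard h
  rcases hx with rfl | rfl | rfl <;> rcases hy with rfl | rfl | rfl <;>
    rcases hz with rfl | rfl | rfl <;> simp_all

/-- An irreducible nonsingular generalized ultrametric matrix is entrywise positive. -/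
theorem MatGenUltrametric.pos {n : ℕ} {C : Matrix (Fin n) (Fin n) ℝ} (h : MatGenUltrametric C)
    (hI : MatIrreducible C) (hC : C.det ≠ 0) (i j : Fin n) : 0 < C i j := by
  have hd : ∀ i, 0 < C i i := by
    intro i
    refine (h.nonneg i i).lt_of_ne fun h0 => hC (Matrix.det_eq_zero_of_row_eq_zero i fun j => ?_)
    exact le_antisymm (h0 ▸ (le_max_left _ _).trans (h.diag i j)) (h.nonneg i j)
  -- Positivity of entries is a transitive relation, so paths in the graph shorten to single arcs.
  have htrans : ∀ i j k, 0 < C i j → 0 < C j k → 0 < C i k := by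
    intro i j k hij hjk
    by_cases h1 : i = j
    · rwa [h1]
    by_cases h2 : j = k
    · rwa [← h2]
    by_cases h3 : i = k
    · rw [h3]; exact hd k
    rcases h.apex h1 h2 h3 with hU | hU | hU
    · rw [← hU.1]; exact hij
    · obtain ⟨e1, e2, e3, -⟩ := hU
      have : 0 < min (C i j) (C j i) := lt_min hij (e1 ▸ hjk)
      exact (lt_min_iff.1 (this.trans_le e3)).1
    · rw [hU.2.1]; exact hjk
  have main : Relation.ReflTransGen (fun p q : Fin n => C p q ≠ 0) i j → 0 < C i j := by
    intro hr
    induction hr with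
    | refl => exact hd i
    | tail _ hbc ih => exact htrans _ _ _ ih ((h.nonneg _ _).lt_of_ne' hbc)
  exact main (hI i j)

/-- In a triple `i < j < k`, the middle index behaves as in the leading block of a cyclops or
as in the trailing block. -/
theorem MatGenUltrametric.middle {n : ℕ} {C : Matrix (Fin n) (Fin n) ℝ}
    (h : MatGenUltrametric C) (hpos : ∀ i j, 0 < C i j) {i j k : Fin n} (hij : i < j) (hjk : j < k)
    (h₁ : C i k * C j j ≤ C i j * C j k) (h₂ : C k i * C j j ≤ C k j * C j i) :
    (C i j = C j j ∧ C j i = C j j ∧ C k i = C k j ∧ C i k = C j k) ∨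
    (C j k = C j j ∧ C k j = C j j ∧ C i j = C i k ∧ C j i = C k i) := by
  obtain ⟨hji, hij'⟩ := max_le_iff.1 (h.diag j i)
  obtain ⟨hjk', hkj⟩ := max_le_iff.1 (h.diag j k)
  rcases h.apex hij.ne hjk.ne (hij.trans hjk).ne with hU | hU | hU
  · obtain ⟨e1, e2, -, -⟩ := hU
    right
    rw [e1] at h₁; rw [e2, mul_comm (C k j)] at h₂
    exact ⟨le_antisymm hjk' (le_of_mul_le_mul_left h₁ (hpos _ _)),
      le_antisymm hkj (le_of_mul_le_mul_left h₂ (hpos _ _)), e1, e2⟩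
  · obtain ⟨e1, e2, e3, e4⟩ := hU
    rw [← e1] at h₁; rw [← e2] at h₂
    have hp := hpos j i
    have hq := hpos i j
    -- With `a = C i j`, `b = C j i`, `d = C j j`, the bounds `h₁`, `h₂` and `e4` give `max a b * d
    -- ≤ a * b`, hence `d ≤ min a b`; dominance gives `a, b ≤ d`.
    have key : C i j = C j j ∧ C j i = C j j := by
      rcases le_max_iff.1 e4 with h5 | h5
      · obtain ⟨h6, h7⟩ := max_le_iff.1 h5
        constructor
        · refine le_antisymm hij' (le_of_mul_le_mul_left ?_ hp)
          nlinarith [hpos j j]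
        · refine le_antisymm hji (le_of_mul_le_mul_left ?_ hq)
          nlinarith [hpos j j]
      · obtain ⟨h6, h7⟩ := max_le_iff.1 h5
        constructor
        · refine le_antisymm hij' (le_of_mul_le_mul_left ?_ hp)
          nlinarith [hpos j j]
        · refine le_antisymm hji (le_of_mul_le_mul_left ?_ hq)
          nlinarith [hpos j j]
    obtain ⟨k1, k2⟩ := key
    rw [k1, k2] at h₁ h₂ e3
    rw [min_self] at e3
    obtain ⟨h6, h7⟩ := le_min_iff.1 e3
    have h8 := le_of_mul_le_mul_right h₁ (hpos j j)
    have h9 := le_of_mul_le_mul_right h₂ (hpos j j)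
    left
    refine ⟨k1, k2, ?_, ?_⟩
    · rw [← e2, k1]; exact le_antisymm h9 h7
    · rw [← e1, k2]; exact le_antisymm h8 h6
  · obtain ⟨e1, e2, -, -⟩ := hU
    left
    rw [e2, mul_comm (C i j)] at h₁; rw [e1] at h₂
    exact ⟨le_antisymm hij' (le_of_mul_le_mul_left h₁ (hpos _ _)),
      le_antisymm hji (le_of_mul_le_mul_left h₂ (hpos _ _)), e1, e2⟩

theorem MatTotallyNonneg.two_by_two {n : ℕ} {C : Matrix (Fin n) (Fin n) ℝ}
    (h : MatTotallyNonneg C) {i j k l : Fin n} (hij : i < j) (hkl : k < l) :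
    C i l * C j k ≤ C i k * C j l := by
  have := h 2 ![i, j] ![k, l] (by rw [Fin.strictMono_iff_lt_succ]; simpa using hij)
    (by rw [Fin.strictMono_iff_lt_succ]; simpa using hkl)
  rw [Matrix.det_fin_two] at this
  simpa using this

/-- Call an index of type `L` or `R` if it behaves as in a leading or a trailing block; every index
has a type. If `j < k` were of types `R` and `L`, rows `j` and `k` would coincide, against
nonsingularity. So the longest initial segment of type `L` is followed only by type `R`, and its
length is the eye. -/
theorem exists_cyclopsForm_of_middle {n : ℕ} (hn : 1 ≤ n) {C : Matrix (Fin n) (Fin n) ℝ}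
    (hC : C.det ≠ 0) (hpos : ∀ i j, 0 < C i j) (hd : ∀ i j, C i j ≤ C i i ∧ C j i ≤ C i i)
    (hmid : ∀ i j k : Fin n, i < j → j < k →
      (C i j = C j j ∧ C j i = C j j ∧ C k i = C k j ∧ C i k = C j k) ∨
      (C j k = C j j ∧ C k j = C j j ∧ C i j = C i k ∧ C j i = C k i)) :
    ∃ (m : ℕ) (b₁ b₂ : ℝ), 1 ≤ m ∧ m ≤ n ∧ CyclopsForm m b₁ b₂ C := by
  classical
  have hrow : ∀ i j, i ≠ j → (∀ l, C i l = C j l) → False := fun i j hij h =>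
    hC (Matrix.det_zero_of_row_eq hij (funext h))
  set L : Fin n → Prop := fun j => ∀ i, i < j → C i j = C j j ∧ C j i = C j j with hL
  set R : Fin n → Prop := fun j => ∀ k, j < k → C j k = C j j ∧ C k j = C j j with hR
  have hLR : ∀ j, ¬ R j → L j := by
    intro j hRj i hij
    simp only [hR, not_forall] at hRj
    obtain ⟨k, hjk, hk⟩ := hRj
    rcases hmid i j k hij hjk with h | h
    · exact ⟨h.1, h.2.1⟩
    · exact absurd ⟨h.1, h.2.1⟩ hk
  have hnotRL : ∀ j k, j < k → ¬ L j → R k := by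
    intro j k hjk hLj
    by_contra hRk
    have hRj : R j := by_contra fun h => hLj (hLR j h)
    have hLk := hLR k hRk
    have e1 := hRj k hjk
    have e2 := hLk j hjk
    refine hrow j k hjk.ne fun l => ?_
    rcases lt_trichotomy l j with hl | rfl | hl
    · rcases hmid l j k hl hjk with h | h
      · rw [h.2.1, h.2.2.1, e1.2]
      · exact h.2.2.2
    · exact e1.2.symm
    · rcases lt_trichotomy l k with hl' | rfl | hl'
      · rw [(hRj l hl).1, (hLk l hl').2, ← e1.1, e2.1]
      · exact e2.1
      · rcases hmid j k l hjk hl' with h | h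
        · exact h.2.2.2
        · rw [h.1, ← h.2.2.1, e2.1]
  set P : ℕ → Prop := fun k => ∀ j : Fin n, j.val < k → L j with hP
  -- The first index is vacuously of type `L`, which is why the eye is at least `1`.
  have hP1 : P 1 := fun j hj i hij => by have := Fin.lt_def.1 hij; omega
  obtain ⟨m, hm⟩ : ∃ m, m = Nat.findGreatest P n := ⟨_, rfl⟩
  have hm1 : 1 ≤ m := hm ▸ Nat.le_findGreatest hn hP1
  have hmn : m ≤ n := hm ▸ Nat.findGreatest_le n
  have hPm : P m := hm ▸ Nat.findGreatest_spec hn hP1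
  have hRm : ∀ j : Fin n, m ≤ j.val → R j := by
    intro j hj
    have hnot : ¬ L ⟨m, by omega⟩ := by
      intro hLm
      have : P (m + 1) := by
        intro i hi
        by_cases him : i.val = m
        · rwa [show i = ⟨m, by omega⟩ from Fin.ext him]
        · exact hPm i (by omega)
      have := Nat.le_findGreatest (show m + 1 ≤ n by omega) this
      omega
    rcases hj.eq_or_lt with h | h
    · by_contra hRj
      exact hnot (by rw [show (⟨m, by omega⟩ : Fin n) = j from Fin.ext h]; exact hLR j hRj)
    · exact hnotRL _ j (Fin.lt_def.2 h) hnot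
  -- The corner entries serve as `b₁` and `b₂`: moving `i` to the first index and `j` to the last
  -- changes nothing within the off-diagonal blocks.
  set o : Fin n := ⟨0, by omega⟩ with ho
  set z : Fin n := ⟨n - 1, by omega⟩ with hz
  have hoff : ∀ i j : Fin n, i.val < m → m ≤ j.val → C i j = C o z ∧ C j i = C z o := by
    intro i j hi hj
    have hij : i < j := Fin.lt_def.2 (by omega)
    have h1 : C i j = C o j ∧ C j i = C j o := by
      rcases (show o ≤ i from Fin.le_def.2 (by simp [ho])).eq_or_lt with h | h
      · rw [h]; exact ⟨rfl, rfl⟩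
      · have hLi := hPm i hi o h
        rcases hmid o i j h hij with h' | h'
        · exact ⟨h'.2.2.2.symm, h'.2.2.1.symm⟩
        · exact ⟨by rw [h'.1, ← h'.2.2.1, hLi.1], by rw [h'.2.1, ← h'.2.2.2, hLi.2]⟩
    have hoj : o < j := Fin.lt_def.2 (by simp [ho]; omega)
    have h2 : C o j = C o z ∧ C j o = C z o := by
      rcases (show j ≤ z from Fin.le_def.2 (by simp [hz]; omega)).eq_or_lt with h | h
      · rw [h]; exact ⟨rfl, rfl⟩
      · have hRj := hRm j hj z h
        rcases hmid o j z hoj h with h' | h'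
        · exact ⟨by rw [h'.1, h'.2.2.2, hRj.1], by rw [h'.2.1, h'.2.2.1, hRj.2]⟩
        · exact h'.2.2
    exact ⟨h1.1.trans h2.1, h1.2.trans h2.2⟩
  have htop : ∀ i j : Fin n, i ≤ j → j.val < m → C i j = C j j ∧ C j i = C j j := by
    intro i j hij hj
    rcases hij.eq_or_lt with rfl | hij
    · exact ⟨rfl, rfl⟩
    · exact hPm j hj i hij
  have hbot : ∀ i j : Fin n, i ≤ j → m ≤ i.val → C i j = C i i ∧ C j i = C i i := by
    intro i j hij hi
    rcases hij.eq_or_lt with rfl | hij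
    · exact ⟨rfl, rfl⟩
    · exact hRm i hi j hij
  have hanti : ∀ i j : Fin n, i ≤ j → j.val < m → C j j ≤ C i i := by
    intro i j hij hj
    rw [← (htop i j hij hj).1]; exact (hd i j).1
  have hmono : ∀ i j : Fin n, i ≤ j → m ≤ i.val → C i i ≤ C j j := by
    intro i j hij hi
    rw [← (hbot i j hij hi).1]; exact (hd j i).2
  refine ⟨m, C o z, C z o, hm1, hmn, htop, hbot, hoff, ?_, ?_, ?_, hpos _ _, hpos _ _⟩
  -- Equal diagonal entries at `i` and `j` would squeeze those between them to the same value and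
  -- make the two rows equal.
  · intro i j hij hj
    have hij' := Fin.lt_def.1 hij
    refine (hanti i j hij.le hj).lt_of_ne fun heq => hrow i j hij.ne fun l => ?_
    rcases le_or_gt l i with hl | hl
    · rw [(htop l i hl (by omega)).2, (htop l j (hl.trans hij.le) hj).2, heq]
    rcases le_or_gt l j with hl' | hl'
    · have hlm : l.val < m := (Fin.le_def.1 hl').trans_lt hj
      rw [(htop i l hl.le hlm).1, (htop l j hl' hj).2]
      exact le_antisymm (heq ▸ hanti i l hl.le hlm) (hanti l j hl' hj)
    by_cases hlm : l.val < m
    · rw [(htop i l hl.le hlm).1, (htop j l hl'.le hlm).1]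
    · rw [(hoff i l (by omega) (by omega)).1, (hoff j l hj (by omega)).1]
  · intro i j hij hi
    have hij' := Fin.lt_def.1 hij
    refine (hmono i j hij.le hi).lt_of_ne fun heq => hrow i j hij.ne fun l => ?_
    rcases le_or_gt j l with hl | hl
    · rw [(hbot j l hl (by omega)).1, (hbot i l (hij.le.trans hl) hi).1, heq]
    rcases le_or_gt i l with hl' | hl'
    · have hlm : m ≤ l.val := hi.trans (Fin.le_def.1 hl')
      rw [(hbot i l hl' hi).1, (hbot l j hl.le hlm).2]
      exact le_antisymm (hmono i l hl' hi) (heq ▸ hmono l j hl.le hlm)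
    by_cases hlm : m ≤ l.val
    · rw [(hbot l i hl'.le hlm).2, (hbot l j hl.le hlm).2]
    · rw [(hoff l i (by omega) (by omega)).2, (hoff l j (by omega) (by omega)).2]
  · intro i
    have hiz : i ≤ z := Fin.le_def.2 (by simp [hz]; omega)
    by_cases hi : i.val < m
    · by_cases hzm : z.val < m
      · have hoz : o ≤ z := Fin.le_def.2 (by simp [ho])
        rw [(htop o z hoz hzm).1, (htop o z hoz hzm).2]
        exact ⟨hanti i z hiz hzm, hanti i z hiz hzm⟩
      · obtain ⟨e1, e2⟩ := hoff i z hi (by omega)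
        rw [← e1, ← e2]; exact hd i z
    · obtain ⟨e1, e2⟩ := hoff o i (by simp [ho]; omega) (by omega)
      rw [← e1, ← e2]; exact (hd i o).symm

theorem MatGenUltrametric.exists_cyclopsForm {n : ℕ} (hn : 1 ≤ n) {C : Matrix (Fin n) (Fin n) ℝ}
    (h : MatGenUltrametric C) (hI : MatIrreducible C) (hC : C.det ≠ 0)
    (hmid : ∀ i j k : Fin n, i < j → j < k →
      C i k * C j j ≤ C i j * C j k ∧ C k i * C j j ≤ C k j * C j i) :
    ∃ (m : ℕ) (b₁ b₂ : ℝ), 1 ≤ m ∧ m ≤ n ∧ CyclopsForm m b₁ b₂ C :=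
  exists_cyclopsForm_of_middle hn hC (h.pos hI hC) (fun i j => max_le_iff.1 (h.diag i j))
    fun i j k hij hjk => h.middle (h.pos hI hC) hij hjk (hmid i j k hij hjk).1
      (hmid i j k hij hjk).2

/-! ### From the inverse to a cyclops -/

theorem MatTridiagonal.rev {n : ℕ} {A : Matrix (Fin n) (Fin n) ℝ} (hT : MatTridiagonal A) :
    MatTridiagonal (A.submatrix Fin.rev Fin.rev) := fun i j hij =>
  hT _ _ (by simp only [Fin.val_rev]; omega)

theorem MatTridiagonal.transpose {n : ℕ} {A : Matrix (Fin n) (Fin n) ℝ} (hT : MatTridiagonal A) :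
    MatTridiagonal A.transpose := fun i j hij => hT j i hij.symm

/-- A row of a tridiagonal matrix applied to a vector that is locally constant on the right. -/
theorem MatTridiagonal.row_sum_mul_rev {n : ℕ} {A : Matrix (Fin n) (Fin n) ℝ}
    (hT : MatTridiagonal A) (v : Fin n → ℝ) {i j : Fin n} (hij : j.val + 1 = i.val)
    (hv : ∀ p : Fin n, p.val = i.val + 1 → v p = v i) :
    ∑ p, A i p * v p = (∑ p, A i p) * v i + A i j * (v j - v i) := by
  have := hT.rev.row_sum_mul (fun p => v p.rev) (i := i.rev) (j := j.rev)
    (by simp only [Fin.val_rev]; omega)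
    (fun p hp => by
      simp only [Fin.rev_rev]
      exact hv _ (by simp only [Fin.val_rev] at *; omega))
  simp only [Matrix.submatrix_apply, Fin.rev_rev] at this
  rw [← Equiv.sum_comp Fin.revPerm, ← Equiv.sum_comp Fin.revPerm (fun p => A i p)]
  exact this

theorem sum_mul_eq_ite {n : ℕ} {A C : Matrix (Fin n) (Fin n) ℝ} (hAC : A * C = 1) (i k : Fin n) :
    ∑ p, A i p * C p k = if i = k then 1 else 0 := by
  rw [← Matrix.one_apply, ← hAC, Matrix.mul_apply]

theorem submatrix_rev_mul_eq_one {n : ℕ} {A C : Matrix (Fin n) (Fin n) ℝ} (hAC : A * C = 1) :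
    A.submatrix Fin.rev Fin.rev * C.submatrix Fin.rev Fin.rev = 1 := by
  have := Matrix.submatrix_mul_equiv A C Fin.rev Fin.revPerm Fin.rev
  rw [hAC] at this
  refine Eq.trans this ?_
  ext i j
  simp [Matrix.one_apply]

theorem transpose_mul_eq_one {n : ℕ} {A C : Matrix (Fin n) (Fin n) ℝ} (hAC : A * C = 1) :
    A.transpose * C.transpose = 1 := by
  rw [← Matrix.transpose_mul, mul_eq_one_comm.1 hAC, Matrix.transpose_one]

/-- The shape of the leading rows of the inverse of a tridiagonal matrix whose leading row sums
vanish. -/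
theorem MatTridiagonal.leading_block {n m : ℕ} {A C : Matrix (Fin n) (Fin n) ℝ}
    (hT : MatTridiagonal A) (hAC : A * C = 1) (hA : ∀ i j : Fin n, i.val + 1 = j.val → A i j < 0)
    (hs : ∀ i : Fin n, i.val + 1 < m → ∑ j, A i j = 0) :
    (∀ i k : Fin n, i ≤ k → k.val < m → C i k = C k k) ∧
    (∀ i j k : Fin n, i.val < m → j.val < m → m ≤ k.val → C i k = C j k) ∧
    (∀ k l : Fin n, k.val + 1 = l.val → l.val < m → C l k < C k k) := by
  have h1 : ∀ i k : Fin n, i ≤ k → k.val < m → C i k = C k k := by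
    intro i k hik hk
    refine hT.eq_of_annihilated (fun i => C i k) (fun i j hij => (hA i j hij).ne)
      (fun i hi => hs i ?_) (fun i hi => ?_) i hik
    · have := Fin.lt_def.1 hi; omega
    · rw [sum_mul_eq_ite hAC, if_neg hi.ne]
  refine ⟨h1, ?_, ?_⟩
  · intro i j k hi hj hk
    have key : ∀ i : Fin n, i.val < m → C i k = C ⟨m - 1, by omega⟩ k := by
      intro i hi
      refine hT.eq_of_annihilated (fun i => C i k) (p := ⟨m - 1, by omega⟩)
        (fun i j hij => (hA i j hij).ne) (fun i hi => hs i ?_) (fun i hi => ?_) i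
        (Fin.le_def.2 (by simp; omega))
      · have := Fin.lt_def.1 hi; simp only at this; omega
      · have := Fin.lt_def.1 hi; simp only at this
        rw [sum_mul_eq_ite hAC, if_neg (fun h => by rw [h] at this; omega)]
    rw [key i hi, key j hj]
  -- Row `k` applied to column `k` reads `1 = A k l * (C l k - C k k)`, with `A k l < 0`.
  · intro k l hkl hl
    have := hT.row_sum_mul (fun i => C i k) hkl (fun r hr =>
      h1 r k (Fin.le_def.2 (by omega)) (by omega))
    rw [sum_mul_eq_ite hAC, if_pos rfl, hs k (by omega)] at this
    have := hA k l hkl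
    by_contra hcon
    nlinarith

/-- The coupling of the two blocks of the inverse of a tridiagonal matrix. -/
theorem MatTridiagonal.middle_block {n : ℕ} {A C : Matrix (Fin n) (Fin n) ℝ}
    (hT : MatTridiagonal A) (hAC : A * C = 1) {p q : Fin n} (hpq : p.val + 1 = q.val)
    (hα : A p q < 0) (hβ : A q p < 0) (hs : 0 ≤ ∑ j, A p j) (hs' : 0 ≤ ∑ j, A q j)
    (hp : ∀ r : Fin n, r.val + 1 = p.val → C r p = C p p ∧ C r q = C p q)
    (hq : ∀ r : Fin n, r.val = q.val + 1 → C r q = C q q ∧ C r p = C q p) :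
    0 < C p q ∧ 0 < C q p ∧ C p q ≤ C q q ∧ C q p ≤ C p p := by
  have hne : p ≠ q := fun h => by rw [h] at hpq; omega
  have e1 := hT.row_sum_mul (fun i => C i p) hpq (fun r hr => (hp r hr).1)
  have e2 := hT.row_sum_mul (fun i => C i q) hpq (fun r hr => (hp r hr).2)
  have e3 := hT.row_sum_mul_rev (fun i => C i p) hpq (fun r hr => (hq r hr).2)
  have e4 := hT.row_sum_mul_rev (fun i => C i q) hpq (fun r hr => (hq r hr).1)
  rw [sum_mul_eq_ite hAC] at e1 e2 e3 e4
  rw [if_pos rfl] at e1 e4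
  rw [if_neg hne] at e2
  rw [if_neg hne.symm] at e3
  generalize (∑ j, A p j) = s at *
  generalize (∑ j, A q j) = s' at *
  generalize A p q = α at *
  generalize A q p = β at *
  generalize C p p = x at *
  generalize C q q = y at *
  generalize C p q = b at *
  generalize C q p = c at *
  -- The four equations say that `!![s - α, α; β, s' - β]` is inverse to `!![x, b; c, y]`; the
  -- quantity here is its determinant, and `k1`, `k2` are Cramer's rule.
  have hcoef : 0 ≤ s * s' - s * β - s' * α := by nlinarith
  have k1 : b * (s * s' - s * β - s' * α) = -α := by linear_combination α * e4 - (s' - β) * e2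
  have k2 : c * (s * s' - s * β - s' * α) = -β := by linear_combination β * e1 - (s - α) * e3
  have hb : 0 < b := by
    by_contra hcon
    have := mul_nonneg (neg_nonneg.2 (not_lt.1 hcon)) hcoef
    linarith
  have hc : 0 < c := by
    by_contra hcon
    have := mul_nonneg (neg_nonneg.2 (not_lt.1 hcon)) hcoef
    linarith
  refine ⟨hb, hc, ?_, ?_⟩
  · by_contra hcon
    nlinarith [mul_nonneg hs hb.le, mul_pos (neg_pos.2 hα) (sub_pos.2 (not_le.1 hcon))]
  · by_contra hcon
    nlinarith [mul_nonneg hs' hc.le, mul_pos (neg_pos.2 hβ) (sub_pos.2 (not_le.1 hcon))]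

theorem sum_submatrix_rev {n : ℕ} (A : Matrix (Fin n) (Fin n) ℝ) (i : Fin n) :
    ∑ j, A.submatrix Fin.rev Fin.rev i j = ∑ j, A i.rev j :=
  Equiv.sum_comp Fin.revPerm (fun j => A i.rev j)

theorem strictAnti_of_adjacent {n m : ℕ} {a : Fin n → ℝ}
    (h : ∀ k l : Fin n, k.val + 1 = l.val → l.val < m → a l < a k) :
    ∀ i j : Fin n, i < j → j.val < m → a j < a i := by
  have main : ∀ d : ℕ, ∀ i j : Fin n, i.val + d + 1 = j.val → j.val < m → a j < a i := by
    intro d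
    induction d with
    | zero => intro i j hij hj; exact h i j hij hj
    | succ d ih =>
      intro i j hij hj
      exact (h ⟨j - 1, by omega⟩ j (by simp; omega) hj).trans
        (ih i ⟨j - 1, by omega⟩ (by simp; omega) (by simp; omega))
  intro i j hij hj
  exact main (j - i - 1) i j (by have := Fin.lt_def.1 hij; omega) hj

/-- The shape of the columns of the inverse of a tridiagonal matrix whose row sums vanish except
possibly in rows `m` and `m + 1`. -/
theorem MatTridiagonal.blocks {n m : ℕ} {A C : Matrix (Fin n) (Fin n) ℝ}
    (hT : MatTridiagonal A) (hAC : A * C = 1)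
    (hA : ∀ i j : Fin n, i.val + 1 = j.val → A i j < 0 ∧ A j i < 0)
    (hs : ∀ i : Fin n, i.val + 1 ≠ m → i.val + 1 ≠ m + 1 → ∑ j, A i j = 0) :
    ((∀ i k : Fin n, i ≤ k → k.val < m → C i k = C k k) ∧
    (∀ i j k : Fin n, i.val < m → j.val < m → m ≤ k.val → C i k = C j k) ∧
    (∀ k l : Fin n, k.val + 1 = l.val → l.val < m → C l k < C k k)) ∧
    ((∀ i k : Fin n, k ≤ i → m ≤ k.val → C i k = C k k) ∧
    (∀ i j k : Fin n, m ≤ i.val → m ≤ j.val → k.val < m → C i k = C j k) ∧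
    (∀ k l : Fin n, l.val + 1 = k.val → m ≤ l.val → C l k < C k k)) := by
  refine ⟨hT.leading_block hAC (fun i j hij => (hA i j hij).1)
    (fun i hi => hs i (by omega) (by omega)), ?_⟩
  obtain ⟨h1, h2, h3⟩ := hT.rev.leading_block (m := n - m) (submatrix_rev_mul_eq_one hAC)
    (fun i j hij => (hA j.rev i.rev (by simp only [Fin.val_rev]; omega)).2)
    (fun i hi => by
      rw [sum_submatrix_rev]
      exact hs _ (by simp only [Fin.val_rev]; omega) (by simp only [Fin.val_rev]; omega))
  simp only [Matrix.submatrix_apply] at h1 h2 h3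
  refine ⟨fun i k hik hk => ?_, fun i j k hi hj hk => ?_, fun k l hkl hl => ?_⟩
  · simpa using h1 i.rev k.rev (Fin.rev_le_rev.2 hik) (by simp only [Fin.val_rev]; omega)
  · simpa using h2 i.rev j.rev k.rev (by simp only [Fin.val_rev]; omega)
      (by simp only [Fin.val_rev]; omega) (by simp only [Fin.val_rev]; omega)
  · simpa using h3 k.rev l.rev (by simp only [Fin.val_rev]; omega)
      (by simp only [Fin.val_rev]; omega)

/-- The row sums control `C` along columns and the column sums control it along rows; together they
fix every block. -/
theorem exists_cyclopsForm_of_inverse {n m : ℕ} {A C : Matrix (Fin n) (Fin n) ℝ} (hm1 : 1 ≤ m)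
    (hmn : m ≤ n) (hAC : A * C = 1) (hT : MatTridiagonal A)
    (hA : ∀ i j : Fin n, i.val + 1 = j.val → A i j < 0 ∧ A j i < 0)
    (hr : ∀ i, 0 ≤ ∑ j, A i j) (hc : ∀ i, 0 ≤ ∑ j, A.transpose i j)
    (hr0 : ∀ i : Fin n, i.val + 1 ≠ m → i.val + 1 ≠ m + 1 → ∑ j, A i j = 0)
    (hc0 : ∀ i : Fin n, i.val + 1 ≠ m → i.val + 1 ≠ m + 1 → ∑ j, A.transpose i j = 0) :
    ∃ b₁ b₂ : ℝ, CyclopsForm m b₁ b₂ C := by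
  have hA' : ∀ i j : Fin n, i.val + 1 = j.val → A.transpose i j < 0 ∧ A.transpose j i < 0 :=
    fun i j hij => (hA i j hij).symm
  have hAC' := transpose_mul_eq_one hAC
  obtain ⟨⟨t1, t2, t3⟩, ⟨s1, s2, s3⟩⟩ := hT.blocks hAC hA hr0
  obtain ⟨⟨u1, u2, u3⟩, ⟨v1, v2, v3⟩⟩ := hT.transpose.blocks hAC' hA' hc0
  simp only [Matrix.transpose_apply] at u1 u2 u3 v1 v2 v3
  have htop : ∀ i j : Fin n, i ≤ j → j.val < m → C i j = C j j ∧ C j i = C j j :=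
    fun i j hij hj => ⟨t1 i j hij hj, u1 i j hij hj⟩
  have hbot : ∀ i j : Fin n, i ≤ j → m ≤ i.val → C i j = C i i ∧ C j i = C i i :=
    fun i j hij hi => ⟨v1 j i hij hi, s1 j i hij hi⟩
  have hanti : ∀ i j : Fin n, i < j → j.val < m → C j j < C i i :=
    strictAnti_of_adjacent (a := fun i => C i i) fun k l hkl hl => by
      rw [← u1 k l (Fin.le_def.2 (by omega)) hl]; exact t3 k l hkl hl
  have hmono : ∀ i j : Fin n, i < j → m ≤ i.val → C i i < C j j := by
    intro i j hij hi
    have := strictAnti_of_adjacent (m := n - m) (a := fun i => C i.rev i.rev) (fun k l hkl hl => by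
      have hk := Fin.val_rev k
      have hl' := Fin.val_rev l
      rw [← v1 k.rev l.rev (Fin.le_def.2 (by omega)) (by omega)]
      exact s3 k.rev l.rev (by omega) (by omega)) j.rev i.rev (Fin.rev_lt_rev.2 hij)
      (by simp only [Fin.val_rev]; omega)
    simpa using this
  have hanti' : ∀ i j : Fin n, i ≤ j → j.val < m → C j j ≤ C i i := fun i j hij hj =>
    hij.eq_or_lt.elim (fun h => h ▸ le_rfl) fun h => (hanti i j h hj).le
  have hmono' : ∀ i j : Fin n, i ≤ j → m ≤ i.val → C i i ≤ C j j := fun i j hij hi =>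
    hij.eq_or_lt.elim (fun h => h ▸ le_rfl) fun h => (hmono i j h hi).le
  obtain ⟨p, hp⟩ : ∃ p : Fin n, p.val + 1 = m := ⟨⟨m - 1, by omega⟩, by simp; omega⟩
  rcases hmn.eq_or_lt with hmn | hmn
  · have e := hT.row_sum_mul_last (fun i => C i p) (hp.trans hmn)
      (fun r hr => t1 r p (Fin.le_def.2 (by omega)) (by omega))
    rw [sum_mul_eq_ite hAC, if_pos rfl] at e
    have hpos : 0 < C p p := by
      by_contra hcon
      have := hr p
      nlinarith
    -- For `m = n` the off-diagonal blocks are empty, so the least diagonal entry can serve as both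
    -- `b₁` and `b₂`.
    refine ⟨C p p, C p p, htop, hbot, fun i j hi hj => by omega, hanti, hmono,
      fun i => ?_, hpos, hpos⟩
    have := hanti' i p (Fin.le_def.2 (by omega)) (by omega)
    exact ⟨this, this⟩
  · obtain ⟨q, hq⟩ : ∃ q : Fin n, q.val = m := ⟨⟨m, hmn⟩, rfl⟩
    have hpq : p.val + 1 = q.val := hp.trans hq.symm
    obtain ⟨k1, k2, k3, k4⟩ := hT.middle_block hAC hpq (hA p q hpq).1 (hA p q hpq).2 (hr p) (hr q)
      (fun r hr => ⟨t1 r p (Fin.le_def.2 (by omega)) (by omega),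
        t2 r p q (by omega) (by omega) (by omega)⟩)
      (fun r hr => ⟨s1 r q (Fin.le_def.2 (by omega)) (by omega),
        s2 r q p (by omega) (by omega) (by omega)⟩)
    -- The transpose supplies the remaining bounds, `b₂ ≤ C q q` and `b₁ ≤ C p p`.
    obtain ⟨-, -, k5, k6⟩ := hT.transpose.middle_block hAC' hpq (hA' p q hpq).1 (hA' p q hpq).2
      (hc p) (hc q)
      (fun r hr => ⟨u1 r p (Fin.le_def.2 (by omega)) (by omega),
        u2 r p q (by omega) (by omega) (by omega)⟩)
      (fun r hr => ⟨v1 r q (Fin.le_def.2 (by omega)) (by omega),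
        v2 r q p (by omega) (by omega) (by omega)⟩)
    simp only [Matrix.transpose_apply] at k5 k6
    refine ⟨C p q, C q p, htop, hbot, fun i j hi hj => ⟨?_, ?_⟩, hanti, hmono,
      fun i => ?_, k1, k2⟩
    · rw [t2 i p j hi (by omega) hj, v2 j q p hj (by omega) (by omega)]
    · rw [u2 i p j hi (by omega) hj, s2 j q p hj (by omega) (by omega)]
    · by_cases hi : i.val < m
      · have := hanti' i p (Fin.le_def.2 (by omega)) (by omega)
        exact ⟨k6.trans this, k4.trans this⟩
      · have := hmono' q i (Fin.le_def.2 (by omega)) (by omega)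
        exact ⟨k3.trans this, k5.trans this⟩

/-! ### The inverse of a cyclops -/

namespace CyclopsForm

variable {n m : ℕ} {b₁ b₂ : ℝ} {C : Matrix (Fin n) (Fin n) ℝ}

/-- Dominance gives the weak inequality; equality would force `C p p = C q q = b₁ = b₂`, and then
rows `p` and `q` coincide. -/
theorem middle_det_pos (h : CyclopsForm m b₁ b₂ C) (hC : C.det ≠ 0) {p q : Fin n}
    (hp : p.val + 1 = m) (hq : q.val = m) : 0 < C p p * C q q - b₁ * b₂ := by
  obtain ⟨l1, l2⟩ := h.le p
  obtain ⟨l3, l4⟩ := h.le q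
  have hb₁ := h.pos₁
  have hb₂ := h.pos₂
  by_contra hcon
  have e1 : C p p = b₁ := by
    by_contra hne
    have := l1.lt_of_ne' hne
    nlinarith [mul_le_mul_of_nonneg_left l4 (h.diag_pos p).le]
  have e2 : C p p = b₂ := by
    by_contra hne
    have := l2.lt_of_ne' hne
    nlinarith [mul_le_mul_of_nonneg_left l3 (h.diag_pos p).le]
  have e3 : C q q = b₁ := le_antisymm (by rw [← e2, e1] at *; nlinarith) l3
  refine hC (Matrix.det_zero_of_row_eq (i := p) (j := q) (fun h => by rw [h] at hp; omega) ?_)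
  funext j
  by_cases hj : j.val < m
  · rw [(h.top j p (Fin.le_def.2 (by omega)) (by omega)).2, (h.off j q hj (by omega)).2, e2]
  · rw [(h.bot q j (Fin.le_def.2 (by omega)) (by omega)).1, (h.off p j (by omega) (by omega)).1, e3]

/-- The row sums of the inverse are the solution of `C *ᵥ x = 1`. -/
theorem _root_.row_sum_inv_eq {n : ℕ} {C : Matrix (Fin n) (Fin n) ℝ} (hC : C.det ≠ 0)
    {x : Fin n → ℝ} (hx : ∀ i, C.mulVec x i = 1) (i : Fin n) : ∑ j, C⁻¹ i j = x i := by
  have : x = C⁻¹.mulVec (C.mulVec x) := by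
    rw [Matrix.mulVec_mulVec, Matrix.nonsing_inv_mul C hC.isUnit, Matrix.one_mulVec]
  rw [this, funext hx]
  simp [Matrix.mulVec, dotProduct]

/-- Restricted to the columns `p`, `q` at the eye, each row of `C` is `(C p p, b₁)` or `(b₂, C q
q)`, so `C x = 1` reduces to a 2×2 system solved by Cramer's rule. For `m = n` only column `p` is
needed. -/
theorem row_sum_inv (h : CyclopsForm m b₁ b₂ C) (hC : C.det ≠ 0) (hm1 : 1 ≤ m) (hmn : m ≤ n) :
    (∀ i, 0 ≤ ∑ j, C⁻¹ i j) ∧ MatRowSumsVanishExcept m C⁻¹ := by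
  obtain ⟨x, hx, hx0, hxm⟩ : ∃ x : Fin n → ℝ, (∀ i, C.mulVec x i = 1) ∧ (∀ i, 0 ≤ x i) ∧
      ∀ i : Fin n, i.val + 1 ≠ m → i.val + 1 ≠ m + 1 → x i = 0 := by
    obtain ⟨p, hp⟩ : ∃ p : Fin n, p.val + 1 = m := ⟨⟨m - 1, by omega⟩, by simp; omega⟩
    have hpp := h.diag_pos p
    rcases hmn.eq_or_lt with hmn | hmn
    · refine ⟨Pi.single p (C p p)⁻¹, fun i => ?_, fun i => ?_, fun i hi _ => ?_⟩
      · rw [Matrix.mulVec_single]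
        simp only [Pi.smul_apply, Matrix.col_apply, MulOpposite.smul_eq_mul_unop,
          MulOpposite.unop_op]
        rw [(h.top i p (Fin.le_def.2 (by omega)) (by omega)).1, mul_inv_cancel₀ hpp.ne']
      · rw [Pi.single_apply]; split_ifs
        exacts [(inv_pos.2 hpp).le, le_rfl]
      · rw [Pi.single_eq_of_ne (fun hip => hi (by rw [hip, hp]))]
    · obtain ⟨q, hq⟩ : ∃ q : Fin n, q.val = m := ⟨⟨m, hmn⟩, rfl⟩
      have hD := h.middle_det_pos hC hp hq
      set D := C p p * C q q - b₁ * b₂ with hDdef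
      refine ⟨Pi.single p ((C q q - b₁) / D) + Pi.single q ((C p p - b₂) / D), fun i => ?_,
        fun i => ?_, fun i hi hi' => ?_⟩
      · rw [Matrix.mulVec_add, Matrix.mulVec_single, Matrix.mulVec_single]
        simp only [Pi.add_apply, Pi.smul_apply, Matrix.col_apply, MulOpposite.smul_eq_mul_unop,
          MulOpposite.unop_op]
        by_cases hi : i.val < m
        · rw [(h.top i p (Fin.le_def.2 (by omega)) (by omega)).1, (h.off i q hi (by omega)).1]
          field_simp
          rw [hDdef]; ring
        · rw [(h.bot q i (Fin.le_def.2 (by omega)) (by omega)).2,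
            (h.off p i (by omega) (by omega)).2]
          field_simp
          rw [hDdef]; ring
      · refine add_nonneg ?_ ?_
        · rw [Pi.single_apply]; split_ifs
          exacts [div_nonneg (sub_nonneg.2 (h.le q).1) hD.le, le_rfl]
        · rw [Pi.single_apply]; split_ifs
          exacts [div_nonneg (sub_nonneg.2 (h.le p).2) hD.le, le_rfl]
      · rw [Pi.add_apply, Pi.single_eq_of_ne (fun hip => hi (by rw [hip, hp])),
          Pi.single_eq_of_ne (fun hip => hi' (by rw [hip, hq])), add_zero]
  refine ⟨fun i => (hx0 i).trans_eq (row_sum_inv_eq hC hx i).symm, fun i hi hi' =>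
    (row_sum_inv_eq hC hx i).trans (hxm i hi hi'), ?_⟩
  by_contra! hcon
  have hx' : x = 0 := by
    funext i
    by_cases hi : i.val + 1 = m ∨ i.val + 1 = m + 1
    · rw [← row_sum_inv_eq hC hx i]; exact hcon i hi
    · rw [not_or] at hi; exact hxm i hi.1 hi.2
  have := hx ⟨0, by omega⟩
  simp [hx'] at this

/-- Signs of the entries of the inverse next to the diagonal. -/
theorem inv_adjacent_neg_aux (h : CyclopsForm m b₁ b₂ C) (hC : C.det ≠ 0) (hm1 : 1 ≤ m)
    (hmn : m ≤ n) {i j : Fin n} (hij : i.val + 1 = j.val) :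
    (i.val < m → C⁻¹ i j < 0) ∧ (m ≤ j.val → C⁻¹ j i < 0) := by
  have hT := h.matTridiagonal_inv hC
  have hAC := Matrix.nonsing_inv_mul C hC.isUnit
  have hs := (h.row_sum_inv hC hm1 hmn).2.1
  have hne : i ≠ j := fun h => by rw [h] at hij; omega
  by_cases hjm : j.val < m
  · refine ⟨fun _ => ?_, fun hj => by omega⟩
    have e := hT.row_sum_mul (fun r => C r i) hij (fun r hr =>
      (h.top r i (Fin.le_def.2 (by omega)) (by omega)).1)
    rw [sum_mul_eq_ite hAC, if_pos rfl, hs i (by omega) (by omega),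
      (h.top i j (Fin.le_def.2 (by omega)) hjm).2] at e
    have := h.anti i j (Fin.lt_def.2 (by omega)) hjm
    by_contra hcon
    nlinarith
  by_cases him : m ≤ i.val
  · refine ⟨fun hi => by omega, fun _ => ?_⟩
    have e := hT.row_sum_mul_rev (fun r => C r j) hij (fun r hr =>
      (h.bot j r (Fin.le_def.2 (by omega)) (by omega)).2)
    rw [sum_mul_eq_ite hAC, if_pos rfl, hs j (by omega) (by omega),
      (h.bot i j (Fin.le_def.2 (by omega)) him).1] at e
    have := h.mono i j (Fin.lt_def.2 (by omega)) him
    by_contra hcon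
    nlinarith
  -- The pair straddles the eye: eliminating the unknown row sum from two equations leaves the
  -- adjacent entry times a positive determinant.
  have hD := h.middle_det_pos hC (p := i) (q := j) (by omega) (by omega)
  have hb₁ := h.pos₁
  have hb₂ := h.pos₂
  obtain ⟨o1, o2⟩ := h.off i j (by omega) (by omega)
  constructor
  · intro _
    have e1 := hT.row_sum_mul (fun r => C r i) hij (fun r hr =>
      (h.top r i (Fin.le_def.2 (by omega)) (by omega)).1)
    have e2 := hT.row_sum_mul (fun r => C r j) hij (fun r hr => by
      rw [(h.off r j (by omega) (by omega)).1, o1])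
    rw [sum_mul_eq_ite hAC, if_pos rfl, o2] at e1
    rw [sum_mul_eq_ite hAC, if_neg hne, o1] at e2
    have key : C⁻¹ i j * (C i i * C j j - b₁ * b₂) = -b₁ := by
      linear_combination b₁ * e1 - C i i * e2
    by_contra hcon
    have := mul_nonneg (not_lt.1 hcon) hD.le
    linarith
  · intro _
    have e1 := hT.row_sum_mul_rev (fun r => C r j) hij (fun r hr =>
      (h.bot j r (Fin.le_def.2 (by omega)) (by omega)).2)
    have e2 := hT.row_sum_mul_rev (fun r => C r i) hij (fun r hr => by
      rw [(h.off i r (by omega) (by omega)).2, o2])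
    rw [sum_mul_eq_ite hAC, if_pos rfl, o1] at e1
    rw [sum_mul_eq_ite hAC, if_neg hne.symm, o2] at e2
    have key : C⁻¹ j i * (C i i * C j j - b₁ * b₂) = -b₂ := by
      linear_combination b₂ * e1 - C j j * e2
    by_contra hcon
    have := mul_nonneg (not_lt.1 hcon) hD.le
    linarith

/-- The row equations reach superdiagonal entries in rows of the leading block and subdiagonal ones
in rows of the trailing block; the transpose covers the rest. -/
theorem inv_adjacent_neg (h : CyclopsForm m b₁ b₂ C) (hC : C.det ≠ 0) (hm1 : 1 ≤ m)
    (hmn : m ≤ n) {i j : Fin n} (hij : i.val + 1 = j.val) : C⁻¹ i j < 0 ∧ C⁻¹ j i < 0 := by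
  have h1 := h.inv_adjacent_neg_aux hC hm1 hmn hij
  have h2 := h.transpose.inv_adjacent_neg_aux (by rwa [Matrix.det_transpose]) hm1 hmn hij
  rw [← Matrix.transpose_nonsing_inv] at h2
  simp only [Matrix.transpose_apply] at h2
  rcases lt_or_ge i.val m with hi | hi
  · exact ⟨h1.1 hi, h2.1 hi⟩
  · exact ⟨h2.2 (by omega), h1.2 (by omega)⟩

theorem inv_nonpos (h : CyclopsForm m b₁ b₂ C) (hC : C.det ≠ 0) (hm1 : 1 ≤ m)
    (hmn : m ≤ n) {i j : Fin n} (hij : i ≠ j) : C⁻¹ i j ≤ 0 := by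
  have hij' : i.val ≠ j.val := fun h => hij (Fin.ext h)
  by_cases h1 : i.val + 1 = j.val
  · exact (h.inv_adjacent_neg hC hm1 hmn h1).1.le
  by_cases h2 : j.val + 1 = i.val
  · exact (h.inv_adjacent_neg hC hm1 hmn h2).2.le
  exact (h.matTridiagonal_inv hC i j (by omega)).le

end CyclopsForm

/-! ### The equivalence -/

theorem mainTheorem9 (n : ℕ) (hn : 1 ≤ n) (C : Matrix (Fin n) (Fin n) ℝ) (hC : C.det ≠ 0) :
    List.TFAE [
      -- (i)
      ∃ m : ℕ, 1 ≤ m ∧ m ≤ n ∧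
        MatIrreducible C⁻¹ ∧ MatRowDominant C⁻¹ ∧ MatColDominant C⁻¹ ∧
        MatTridiagonal C⁻¹ ∧ MatIsM C⁻¹ ∧
        MatRowSumsVanishExcept m C⁻¹ ∧ MatRowSumsVanishExcept m (C⁻¹).transpose,
      -- (ii); the bound on the parameter number m + 1 is void when m = n
      ∃ (m : ℕ) (_ : 1 ≤ m) (hm : m ≤ n) (a : Fin n → ℝ) (b₁ b₂ : ℝ),
        MatCyclops m hm a b₁ b₂ C ∧
        (∀ i : Fin n, i.val + 1 = m ∨ i.val + 1 = m + 1 → max b₁ b₂ ≤ a i) ∧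
        0 < min b₁ b₂,
      -- (iii)
      MatIrreducible C ∧ MatGenUltrametric C ∧ MatTridiagonal C⁻¹,
      -- (iv)
      MatTotallyNonneg C ∧ MatIrreducible C ∧ MatGenUltrametric C] := by
  have h12 : (∃ m : ℕ, 1 ≤ m ∧ m ≤ n ∧
        MatIrreducible C⁻¹ ∧ MatRowDominant C⁻¹ ∧ MatColDominant C⁻¹ ∧
        MatTridiagonal C⁻¹ ∧ MatIsM C⁻¹ ∧
        MatRowSumsVanishExcept m C⁻¹ ∧ MatRowSumsVanishExcept m (C⁻¹).transpose) ↔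
      ∃ (m : ℕ) (b₁ b₂ : ℝ), 1 ≤ m ∧ m ≤ n ∧ CyclopsForm m b₁ b₂ C := by
    constructor
    · rintro ⟨m, hm1, hmn, hI, hR, hCol, hT, hM, hr, hc⟩
      have hA : ∀ i j : Fin n, i.val + 1 = j.val → C⁻¹ i j < 0 ∧ C⁻¹ j i < 0 := by
        intro i j hij
        have hne : i ≠ j := fun h => by rw [h] at hij; omega
        obtain ⟨h1, h2⟩ := hI.apply_ne_zero_of_matTridiagonal hT hij
        exact ⟨(hM.apply_nonpos hne).lt_of_ne h1, (hM.apply_nonpos hne.symm).lt_of_ne h2⟩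
      obtain ⟨b₁, b₂, h⟩ := exists_cyclopsForm_of_inverse hm1 hmn
        (Matrix.nonsing_inv_mul C hC.isUnit) hT hA
        (fun i => hR.row_sum_nonneg (hM.diag_nonneg i))
        (fun i => MatRowDominant.row_sum_nonneg hCol (hM.diag_nonneg i)) hr.1 hc.1
      exact ⟨m, b₁, b₂, hm1, hmn, h⟩
    · rintro ⟨m, b₁, b₂, hm1, hmn, h⟩
      obtain ⟨hr, hr'⟩ := h.row_sum_inv hC hm1 hmn
      obtain ⟨hc, hc'⟩ := h.transpose.row_sum_inv (by rwa [Matrix.det_transpose]) hm1 hmn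
      rw [← Matrix.transpose_nonsing_inv] at hc'
      simp only [← Matrix.transpose_nonsing_inv] at hc
      have ho : ∀ i j, i ≠ j → C⁻¹ i j ≤ 0 := fun i j hij => h.inv_nonpos hC hm1 hmn hij
      exact ⟨m, hm1, hmn, matIrreducible_of_adjacent_ne_zero fun i j hij =>
        ⟨(h.inv_adjacent_neg hC hm1 hmn hij).1.ne, (h.inv_adjacent_neg hC hm1 hmn hij).2.ne⟩,
        matRowDominant_of_row_sum_nonneg ho hr,
        matRowDominant_of_row_sum_nonneg (fun i j hij => ho j i hij.symm) hc,
        h.matTridiagonal_inv hC, matIsM_of_row_sum_nonneg ho hr, hr', hc'⟩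
  tfae_have 1 → 2 := by
    intro h
    obtain ⟨m, b₁, b₂, hm1, hmn, h⟩ := h12.1 h
    exact ⟨m, hm1, hmn, fun i => C i i, b₁, b₂, h.matCyclops hmn,
      fun i _ => max_le (h.le i).1 (h.le i).2, lt_min h.pos₁ h.pos₂⟩
  tfae_have 2 → 1 := by
    rintro ⟨m, hm1, hmn, a, b₁, b₂, h, hle, hpos⟩
    exact h12.2 ⟨m, b₁, b₂, hm1, hmn, h.cyclopsForm hm1 hle hpos⟩
  tfae_have 2 → 3 := by
    rintro ⟨m, hm1, hmn, a, b₁, b₂, h, hle, hpos⟩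
    have h := h.cyclopsForm hm1 hle hpos
    exact ⟨h.matIrreducible, h.matGenUltrametric, h.matTridiagonal_inv hC⟩
  tfae_have 2 → 4 := by
    rintro ⟨m, hm1, hmn, a, b₁, b₂, h, hle, hpos⟩
    have h := h.cyclopsForm hm1 hle hpos
    exact ⟨h.matTotallyNonneg, h.matIrreducible, h.matGenUltrametric⟩
  tfae_have 3 → 1 := by
    rintro ⟨hI, hU, hT⟩
    have hd : ∀ j, C j j ≠ 0 := fun j => (hU.pos hI hC j j).ne'
    refine h12.2 (hU.exists_cyclopsForm hn hI hC fun i j k hij hjk => ⟨?_, ?_⟩)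
    · exact (factor_of_matTridiagonal_inv hC hT hij hjk (hd j)).le
    · have := factor_of_matTridiagonal_inv (C := C.transpose) (by rwa [Matrix.det_transpose])
        (by rw [← Matrix.transpose_nonsing_inv]; exact hT.transpose) hij hjk (hd j)
      simp only [Matrix.transpose_apply] at this
      rw [this, mul_comm]
  tfae_have 4 → 1 := by
    -- The two inequalities are the minors on rows `i, j` and columns `j, k`, and on rows `j, k` and
    -- columns `i, j`.
    rintro ⟨hN, hI, hU⟩
    refine h12.2 (hU.exists_cyclopsForm hn hI hC fun i j k hij hjk =>
      ⟨hN.two_by_two hij hjk, ?_⟩)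
    have := hN.two_by_two hjk hij
    linarith
  tfae_finish
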